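/- Let $H$ be a complex Hilbert space (of arbitrary, possibly infinite, dimension), let $k$ be an integer with $\dim H>2k>2$, and let ${\mathcal G}_k(H)$ be the set of all $k$-dimensional subspaces of $H$. The principal angles $0\le\theta_1\le\dots\le\theta_k\le\pi/2$ between $X,Y\in{\mathcal G}_k(H)$ are defined recursively: $\theta_i$ is the minimal value of $\arccos|\langle x,y\rangle|$ over all unit vectors $x\in X$ and $y\in Y$ such that $x$ is orthogonal to $x_1,\dots,x_{i-1}$ and $y$ is orthogonal to $y_1,\dots,y_{i-1}$, and $x_i\in X$, $y_i\in Y$ is a pair of such vectors at which this minimum is attained. Two elements of ${\mathcal G}_k(H)$ are called adjacent if their intersection is $(k-1)$-dimensional (equivalently, exactly one of the principal angles between them is non-zero); two adjacent elements are called ortho-adjacent if the unique non-zero principal angle between them is equal to $\pi/2$. A map $f:{\mathcal G}_k(H)\to{\mathcal G}_k(H)$ preserves a relation $R$ on ${\mathcal G}_k(H)$ if $X\,R\,Y$ implies $f(X)\,R\,f(Y)$ for all $X,Y\in{\mathcal G}_k(H)$. **Theorem 1.** Let $f:{\mathcal G}_k(H)\to{\mathcal G}_k(H)$ be a (not necessarily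 injective or surjective) map which preserves orthogonality, i.e. $X\perp Y$ implies $f(X)\perp f(Y)$. Suppose that $f$ satisfies at least one of the following conditions: (A) $f$ preserves adjacency; (OA) $f$ is injective and preserves ortho-adjacency. Then $f$ is induced by a linear or conjugate-linear isometry of $H$, i.e. there is a linear or conjugate-linear (not necessarily surjective) isometry $U:H\to H$ such that $f(X)=U(X)$ for every $X\in{\mathcal G}_k(H)$. -/

import Mathlib

namespace HilbertGrassmannian

variable {H : Type*} [NormedAddCommGroup H] [InnerProductSpace ℂ H]

/-- The Grassmannian `G_k(H)` of all `k`-dimensional subspaces of a complex Hilbert space. -/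
def Grassmannian (k : ℕ) (H : Type*) [NormedAddCommGroup H] [InnerProductSpace ℂ H] : Type _ :=
  {X : Submodule ℂ H // FiniteDimensional ℂ X ∧ Module.finrank ℂ X = k}

/-- `f` preserves the relation `R` (in one direction): `x R y` implies `f x R f y`. -/
def Preserves {S : Type*} (R : S → S → Prop) (f : S → S) : Prop :=
  ∀ x y, R x y → R (f x) (f y)

/-- The orthogonality relation on `G_k(H)`. -/
def Orthogonal {k : ℕ} (X Y : Grassmannian k H) : Prop :=
  X.1 ⟂ Y.1

/-- Two elements of `G_k(H)` are adjacent if their intersection is `(k-1)`-dimensional. -/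
def Adjacent {k : ℕ} (X Y : Grassmannian k H) : Prop :=
  Module.finrank ℂ (X.1 ⊓ Y.1 : Submodule ℂ H) + 1 = k

/-- `u` and `v` are competitors at step `i` of the recursive definition of principal angles, given
the earlier choices `x j`, `y j` with `j < i`: they are unit vectors of `X` and `Y` orthogonal to
the earlier `x j`, respectively the earlier `y j`. -/
def IsCompetitor {k : ℕ} (X Y : Submodule ℂ H) (x y : Fin k → H) (i : Fin k) (u v : H) : Prop :=
  u ∈ X ∧ v ∈ Y ∧ ‖u‖ = 1 ∧ ‖v‖ = 1 ∧
    ∀ j, j < i → inner ℂ (x j) u = 0 ∧ inner ℂ (y j) v = 0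

/-- `θ` is the sequence of principal angles between `X` and `Y`: at each step `i` the angle `θ i`
is the minimum of `arccos |⟨u, v⟩|` over all competitors, and it is attained at `(x i, y i)`. -/
def IsPrincipalAngles {k : ℕ} (X Y : Submodule ℂ H) (θ : Fin k → ℝ) : Prop :=
  ∃ x y : Fin k → H, ∀ i,
    IsCompetitor X Y x y i (x i) (y i) ∧
    θ i = Real.arccos ‖inner ℂ (x i) (y i)‖ ∧
    ∀ u v, IsCompetitor X Y x y i u v → θ i ≤ Real.arccos ‖inner ℂ u v‖

/-- Two adjacent elements of `G_k(H)` are ortho-adjacent if the unique non-zero principal angle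
between them is `π / 2`. -/
def OrthoAdjacent {k : ℕ} (X Y : Grassmannian k H) : Prop :=
  Adjacent X Y ∧ ∃ θ : Fin k → ℝ, IsPrincipalAngles X.1 Y.1 θ ∧
    ∀ i, θ i ≠ 0 → θ i = Real.pi / 2

/-- `f` is induced by a linear isometry of `H` (not necessarily surjective): `f X = U(X)`. -/
def InducedByLinearIsometry {k : ℕ} (f : Grassmannian k H → Grassmannian k H) : Prop :=
  ∃ U : H →ₗᵢ[ℂ] H, ∀ X, (f X).1 = X.1.map U.toLinearMap

/-- `f` is induced by a conjugate-linear isometry of `H` (not necessarily surjective). -/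
def InducedByConjLinearIsometry {k : ℕ} (f : Grassmannian k H → Grassmannian k H) : Prop :=
  ∃ U : H →ₛₗᵢ[starRingEnd ℂ] H, ∀ X, (f X).1 = X.1.map U.toLinearMap

end HilbertGrassmannian

namespace HilbertGrassmannian

open Module Submodule

variable {H : Type*} [NormedAddCommGroup H] [InnerProductSpace ℂ H]

/-! The proof reduces `k`-dimensional subspaces to lines, one dimension at a time, and then
reconstructs an isometry from its action on lines.

For the reduction, let `f` preserve orthogonality and adjacency, and let `Z` have dimension `k - 1`.
The subspaces `X ⊇ Z` (a star) are pairwise adjacent, so their images all contain one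
`(k-1)`-dimensional subspace or all lie in one `(k+1)`-dimensional subspace (a top). Orthogonality
and `dim H ≥ 2k + 1` exclude the top (`exists_star`). Sending `Z` to the subspace common to the
images gives a map one dimension lower that again preserves orthogonality and adjacency
(`exists_descent`). Both arguments use that adjacency preserving maps never shrink the dimension of
an intersection (`le_inter`).

On lines, one gets a map `g` preserving orthogonality, independence and coplanarity. With a unit
vector `e` and a unit `a ∈ g e`, the line of `e + v`, `v ⟂ e`, goes to the line of `a + U v`; this
defines `U`, and orthogonality of `e + v` and `e + w` says `⟨v, w⟩ = -1`, which recovers the metric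
(`exists_isSemiIsometry_of_lines`).

Condition (OA) reduces to (A). A star contains `k + 2` pairwise ortho-adjacent elements, a top at
most `k + 1` (`card_le_of_orthoAdj`), so the images of such a family lie in a star; with injectivity
this gives adjacency (`PreservesOrthoAdjacent.adj`). -/

/-- `X` is a `k`-dimensional subspace. -/
def HasDim (k : ℕ) (X : Submodule ℂ H) : Prop :=
  FiniteDimensional ℂ X ∧ finrank ℂ X = k

/-! ### Dimension counting and orthogonal extensions. -/

namespace HasDim

variable {a b : ℕ} {A B : Submodule ℂ H}

theorem unique (h : HasDim a A) (h' : HasDim b A) : a = b := h.2.symm.trans h'.2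

theorem le_dim (hA : HasDim a A) (hB : HasDim b B) (h : A ≤ B) : a ≤ b := by
  have := hB.1
  rw [← hA.2, ← hB.2]
  exact Submodule.finrank_mono h

theorem mono (hB : HasDim b B) (h : A ≤ B) : ∃ a ≤ b, HasDim a A := by
  have := hB.1
  have : FiniteDimensional ℂ A := Submodule.finiteDimensional_of_le h
  exact ⟨_, HasDim.le_dim ⟨this, rfl⟩ hB h, this, rfl⟩

theorem eq_of_le (hA : HasDim a A) (hB : HasDim b B) (h : A ≤ B) (hba : b ≤ a) : A = B := by
  have := hB.1
  exact Submodule.eq_of_le_of_finrank_le h (by rw [hA.2, hB.2]; exact hba)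

theorem sup_inf (hA : HasDim a A) (hB : HasDim b B) :
    ∃ s i, HasDim s (A ⊔ B) ∧ HasDim i (A ⊓ B) ∧ s + i = a + b := by
  have := hA.1
  have := hB.1
  refine ⟨_, _, ⟨inferInstance, rfl⟩, ⟨inferInstance, rfl⟩, ?_⟩
  rw [Submodule.finrank_sup_add_finrank_inf_eq, hA.2, hB.2]

theorem bot : HasDim 0 (⊥ : Submodule ℂ H) := ⟨inferInstance, finrank_bot ℂ H⟩

theorem eq_bot (hA : HasDim 0 A) : A = ⊥ := (bot.eq_of_le hA bot_le le_rfl).symm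

theorem ne_bot (hA : HasDim a A) (ha : a ≠ 0) : A ≠ ⊥ := by
  rintro rfl
  exact ha (hA.unique bot)

theorem span_singleton {x : H} (hx : x ≠ 0) : HasDim 1 (ℂ ∙ x) :=
  ⟨inferInstance, finrank_span_singleton hx⟩

theorem sup_disjoint (hA : HasDim a A) (hB : HasDim b B) (h : A ⊓ B = ⊥) :
    HasDim (a + b) (A ⊔ B) := by
  obtain ⟨s, i, hs, hi, e⟩ := hA.sup_inf hB
  rw [h] at hi
  have := hi.unique bot
  obtain rfl : s = a + b := by omega
  exact hs

theorem sup_ortho (hA : HasDim a A) (hB : HasDim b B) (h : A ⟂ B) : HasDim (a + b) (A ⊔ B) :=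
  hA.sup_disjoint hB h.disjoint.eq_bot

theorem sup_span (hA : HasDim a A) {x : H} (hx : x ∉ A) : HasDim (a + 1) (A ⊔ ℂ ∙ x) := by
  have h0 : x ≠ 0 := fun h => hx (h ▸ A.zero_mem)
  exact hA.sup_disjoint (span_singleton h0)
    ((Submodule.disjoint_span_singleton' h0).2 hx).eq_bot

theorem not_le (hA : HasDim a A) (hB : HasDim b B) (h : b < a) : ∃ x ∈ A, x ∉ B := by
  by_contra! hc
  exact absurd (hA.le_dim hB hc) (by omega)

theorem exists_between (hA : HasDim a A) (hB : HasDim b B) (h : A ≤ B) {m : ℕ} (ham : a ≤ m)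
    (hmb : m ≤ b) : ∃ C, A ≤ C ∧ C ≤ B ∧ HasDim m C := by
  induction m, ham using Nat.le_induction with
  | base => exact ⟨A, le_rfl, h, hA⟩
  | succ m _ ih =>
    obtain ⟨C, h1, h2, h3⟩ := ih (by omega)
    obtain ⟨x, hx, hxC⟩ := hB.not_le h3 (by omega)
    exact ⟨_, h1.trans le_sup_left, sup_le h2 ((span_singleton_le_iff_mem _ _).2 hx),
      h3.sup_span hxC⟩

/-- A natural lower bound `n` for the rank treats finite and infinite dimension alike.
Finite-dimensional subspaces are complete, so completeness of `H` plays no role. -/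
theorem exists_orthogonal {n : ℕ} (hn : (n : Cardinal) ≤ Module.rank ℂ H) (hA : HasDim a A)
    (h : a < n) : ∃ x : H, x ≠ 0 ∧ A ⟂ ℂ ∙ x := by
  have := hA.1
  have h1 : A ≠ ⊤ := by
    rintro rfl
    have h2 := finrank_eq_rank ℂ (⊤ : Submodule ℂ H)
    rw [hA.2, rank_top] at h2
    rw [← h2] at hn
    exact absurd (Nat.cast_le.1 hn) (by omega)
  obtain ⟨x, hx, h0⟩ := Submodule.exists_mem_ne_zero_of_ne_bot
    (mt Submodule.orthogonal_eq_bot_iff.1 h1)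
  refine ⟨x, h0, ?_⟩
  rw [isOrtho_comm, isOrtho_iff_le]
  exact (span_singleton_le_iff_mem _ _).2 hx

/-- A subspace orthogonal to `B` extends to one of any dimension that leaves room for `B`. -/
theorem exists_extension {n : ℕ} (hn : (n : Cardinal) ≤ Module.rank ℂ H) (hA : HasDim a A)
    (hB : HasDim b B) (h : A ⟂ B) {p : ℕ} (hap : a ≤ p) (hpn : p + b ≤ n) :
    ∃ X, A ≤ X ∧ X ⟂ B ∧ HasDim p X := by
  induction p, hap using Nat.le_induction with
  | base => exact ⟨A, le_rfl, h, hA⟩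
  | succ p _ ih =>
    obtain ⟨X, h1, h2, h3⟩ := ih (by omega)
    obtain ⟨x, h0, hx⟩ := (h3.sup_ortho hB h2).exists_orthogonal hn (by omega)
    rw [isOrtho_sup_left] at hx
    exact ⟨X ⊔ ℂ ∙ x, h1.trans le_sup_left, isOrtho_sup_left.2 ⟨h2, hx.2.symm⟩,
      h3.sup_ortho (span_singleton h0) hx.1⟩

theorem exists_ortho {n : ℕ} (hn : (n : Cardinal) ≤ Module.rank ℂ H)
    (hB : HasDim b B) {p : ℕ} (hpn : p + b ≤ n) : ∃ X, X ⟂ B ∧ HasDim p X := by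
  obtain ⟨X, -, h, h'⟩ := HasDim.bot.exists_extension hn hB isOrtho_bot_left (Nat.zero_le p) hpn
  exact ⟨X, h, h'⟩

end HasDim

/-! ### Adjacency, stars and tops. -/

/-- Adjacency of `(m + 1)`-dimensional subspaces. -/
structure Adj (m : ℕ) (A B : Submodule ℂ H) : Prop where
  left : HasDim (m + 1) A
  right : HasDim (m + 1) B
  inter : HasDim m (A ⊓ B)

namespace Adj

variable {m : ℕ} {A B C : Submodule ℂ H}

theorem symm (h : Adj m A B) : Adj m B A := ⟨h.right, h.left, inf_comm A B ▸ h.inter⟩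

theorem ne (h : Adj m A B) : A ≠ B := by
  rintro rfl
  have := h.inter
  rw [inf_idem] at this
  exact absurd (this.unique h.left) (by omega)

theorem sup (h : Adj m A B) : HasDim (m + 2) (A ⊔ B) := by
  obtain ⟨s, i, hs, hi, e⟩ := h.left.sup_inf h.right
  have := hi.unique h.inter
  obtain rfl : s = m + 2 := by omega
  exact hs

theorem of_common (hA : HasDim (m + 1) A) (hB : HasDim (m + 1) B) (hne : A ≠ B)
    (hC : HasDim m C) (h1 : C ≤ A) (h2 : C ≤ B) : Adj m A B := by
  refine ⟨hA, hB, ?_⟩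
  obtain ⟨i, hi, h⟩ := hA.mono (inf_le_left : A ⊓ B ≤ A)
  have := hC.le_dim h (le_inf h1 h2)
  rcases Nat.lt_or_ge m i with h' | h'
  · have e1 := h.eq_of_le hA inf_le_left h'
    have e2 := h.eq_of_le hB inf_le_right h'
    exact absurd (e1.symm.trans e2) hne
  · obtain rfl : i = m := by omega
    exact h

theorem of_sup_le (hA : HasDim (m + 1) A) (hB : HasDim (m + 1) B) (hne : A ≠ B)
    (hC : HasDim (m + 2) C) (h1 : A ≤ C) (h2 : B ≤ C) : Adj m A B := by
  obtain ⟨s, i, hs, hi, e⟩ := hA.sup_inf hB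
  have := hs.le_dim hC (sup_le h1 h2)
  obtain ⟨D, -, h3, h4⟩ := HasDim.bot.exists_between hi bot_le (Nat.zero_le m) (by omega)
  exact of_common hA hB hne h4 (h3.trans inf_le_left) (h3.trans inf_le_right)

/-- A subspace adjacent to two adjacent subspaces contains their intersection or is contained in
their sum. -/
theorem inf_le_or_le_sup (h : Adj m A B) (hA : Adj m A C) (hB : Adj m B C) :
    A ⊓ B ≤ C ∨ C ≤ A ⊔ B := by
  by_cases hC : C ≤ A ⊔ B
  · exact Or.inr hC
  left
  -- `C ⊓ (A ⊔ B)` is proper in `C`, so its `m`-dimensional subspaces `A ⊓ C` and `B ⊓ C` both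
  -- exhaust it, hence coincide with `A ⊓ B`.
  obtain ⟨d, hd, hD⟩ := hA.right.mono (inf_le_left : C ⊓ (A ⊔ B) ≤ C)
  have hdm : d ≤ m := by
    by_contra! hdm
    exact hC (inf_eq_left.1 (hD.eq_of_le hA.right inf_le_left hdm))
  have e1 := hA.inter.eq_of_le hD (le_inf inf_le_right (inf_le_left.trans le_sup_left)) hdm
  have e2 := hB.inter.eq_of_le hD (le_inf inf_le_right (inf_le_left.trans le_sup_right)) hdm
  have e3 := hA.inter.eq_of_le h.inter
    (le_inf inf_le_left ((e1.trans e2.symm).le.trans inf_le_left)) le_rfl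
  exact e3.ge.trans inf_le_right

/-- A family of pairwise equal or adjacent subspaces is contained in a star or in a top. -/
theorem star_or_top (h : Adj m A B) {S : Set (Submodule ℂ H)} (hA : A ∈ S) (hB : B ∈ S)
    (hS : ∀ X ∈ S, ∀ Y ∈ S, X = Y ∨ Adj m X Y) :
    (∀ X ∈ S, A ⊓ B ≤ X) ∨ ∀ X ∈ S, X ≤ A ⊔ B := by
  have key : ∀ X ∈ S, A ⊓ B ≤ X ∨ X ≤ A ⊔ B := by
    intro X hX
    rcases hS A hA X hX with rfl | h1
    · exact Or.inl inf_le_left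
    rcases hS B hB X hX with rfl | h2
    · exact Or.inl inf_le_right
    exact h.inf_le_or_le_sup h1 h2
  by_contra! hc
  obtain ⟨⟨C, hC, hC'⟩, D, hD, hD'⟩ := hc
  have hCle := (key C hC).resolve_left hC'
  have hDge := (key D hD).resolve_right hD'
  have hAC : Adj m A C := (hS A hA C hC).resolve_left (by rintro rfl; exact hC' inf_le_left)
  have hAD : Adj m A D := (hS A hA D hD).resolve_left (by rintro rfl; exact hD' le_sup_left)
  have hCD : Adj m C D := (hS C hC D hD).resolve_left (by rintro rfl; exact hC' hDge)
  -- The triangle `A`, `C`, `D` forces `A ⊓ C = A ⊓ D = A ⊓ B`, so `C` would contain `A ⊓ B`.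
  have h1 := (hAC.inf_le_or_le_sup hAD hCD).resolve_right
    fun h' => hD' (h'.trans (sup_le le_sup_left hCle))
  have e1 := h.inter.eq_of_le hAD.inter (le_inf inf_le_left hDge) le_rfl
  have e2 := hAC.inter.eq_of_le hAD.inter (le_inf inf_le_left h1) le_rfl
  exact hC' ((e1.trans e2.symm).le.trans inf_le_right)

end Adj

/-! ### Descent from dimension `k` to dimension `k - 1`. -/

/-- A map of `(m + 1)`-dimensional subspaces that preserves orthogonality and adjacency. -/
structure PreservesOrthoAdj (m : ℕ) (F : Submodule ℂ H → Submodule ℂ H) : Prop where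
  dim : ∀ {X}, HasDim (m + 1) X → HasDim (m + 1) (F X)
  ortho : ∀ {X Y}, HasDim (m + 1) X → HasDim (m + 1) Y → X ⟂ Y → F X ⟂ F Y
  adj : ∀ {X Y}, Adj m X Y → Adj m (F X) (F Y)

namespace PreservesOrthoAdj

variable {m : ℕ} {F : Submodule ℂ H → Submodule ℂ H}

/-- Adjacency preserving maps do not decrease the dimension of intersections. -/
theorem le_inter (hF : PreservesOrthoAdj m F) {X Y : Submodule ℂ H} (hX : HasDim (m + 1) X)
    (hY : HasDim (m + 1) Y) {a b : ℕ} (ha : HasDim a (X ⊓ Y)) (hb : HasDim b (F X ⊓ F Y)) :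
    a ≤ b := by
  have base : ∀ Y : Submodule ℂ H, HasDim (m + 1) Y → ∀ a b, HasDim a (X ⊓ Y) →
      HasDim b (F X ⊓ F Y) → m + 1 ≤ a → a ≤ b := by
    intro Y hY a b ha hb hd
    obtain rfl : X = Y :=
      (ha.eq_of_le hX inf_le_left hd).symm.trans (ha.eq_of_le hY inf_le_right hd)
    rw [inf_idem] at ha hb
    exact (ha.unique hX).le.trans (hb.unique (hF.dim hX)).ge
  have key : ∀ d : ℕ, ∀ Y : Submodule ℂ H, HasDim (m + 1) Y → ∀ a b, HasDim a (X ⊓ Y) →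
      HasDim b (F X ⊓ F Y) → m + 1 ≤ a + d → a ≤ b := by
    intro d
    induction d with
    | zero => exact base
    | succ d ih =>
      intro Y hY a b ha hb hd
      rcases Nat.lt_or_ge a (m + 1) with ham | ham
      swap
      · exact base Y hY a b ha hb ham
      obtain ⟨x, hx, hxI⟩ := hX.not_le ha ham
      have hxY : x ∉ Y := fun h => hxI ⟨hx, h⟩
      -- Replace `Y` by the adjacent `Z ⊔ ℂ ∙ x`, which meets `X` in a larger dimension. Going back
      -- to `F Y` costs at most one dimension, since `F Y` contains a hyperplane of `F (Z ⊔ ℂ ∙ x)`.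
      obtain ⟨Z, hZ, hZY, hZm⟩ := ha.exists_between hY inf_le_right (m := m) (by omega) (by omega)
      have hY' := hZm.sup_span (fun h => hxY (hZY h))
      have hadj : Adj m (Z ⊔ ℂ ∙ x) Y := Adj.of_common hY' hY
        (fun h => hxY (h ▸ (le_sup_right : ℂ ∙ x ≤ Z ⊔ ℂ ∙ x) (mem_span_singleton_self x)))
        hZm le_sup_left hZY
      obtain ⟨i, hi, hi'⟩ := hX.mono (inf_le_left : X ⊓ (Z ⊔ ℂ ∙ x) ≤ X)
      have h1 := (ha.sup_span hxI).le_dim hi'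
        (le_inf (sup_le inf_le_left ((span_singleton_le_iff_mem _ _).2 hx))
          (sup_le_sup_right hZ _))
      obtain ⟨b', hb', hb''⟩ := (hF.dim hX).mono (inf_le_left : F X ⊓ F (Z ⊔ ℂ ∙ x) ≤ F X)
      have h2 := ih _ hY' i b' hi' hb'' (by omega)
      obtain ⟨s, j, hs, hj, e⟩ := hb''.sup_inf (hF.adj hadj).inter
      have h3 := hs.le_dim (hF.dim hY') (sup_le inf_le_right inf_le_left)
      have h4 := hj.le_dim hb
        (le_inf (inf_le_left.trans inf_le_left) (inf_le_right.trans inf_le_right))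
      omega
  exact key (m + 1) Y hY a b ha hb (by omega)

end PreservesOrthoAdj

theorem Adj.sup_span {m : ℕ} {Z : Submodule ℂ H} (hZ : HasDim m Z) {x y : H}
    (hy : y ∉ Z) (hxy : x ∉ Z ⊔ ℂ ∙ y) : Adj m (Z ⊔ ℂ ∙ x) (Z ⊔ ℂ ∙ y) :=
  Adj.of_common (hZ.sup_span fun h => hxy ((le_sup_left : Z ≤ _) h)) (hZ.sup_span hy)
    (fun h => hxy (h ▸ (le_sup_right : ℂ ∙ x ≤ Z ⊔ ℂ ∙ x) (mem_span_singleton_self x)))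
    hZ le_sup_left le_sup_left

theorem HasDim.exists_span_pair {R : Submodule ℂ H} {r : ℕ} (hR : HasDim r R) (hr : 2 ≤ r) :
    ∃ x ∈ R, ∃ y ∈ R, y ≠ 0 ∧ x ∉ ℂ ∙ y := by
  obtain ⟨y, hy, hy0⟩ := Submodule.exists_mem_ne_zero_of_ne_bot (hR.ne_bot (by omega))
  obtain ⟨x, hx, hxy⟩ := hR.not_le (HasDim.span_singleton hy0) (by omega)
  exact ⟨x, hx, y, hy, hy0, hxy⟩

theorem HasDim.sup_span_isOrtho {Z : Submodule ℂ H} {m : ℕ} (hZ : HasDim m Z) {x : H} (hx : x ≠ 0)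
    (h : Z ⟂ ℂ ∙ x) : HasDim (m + 1) (Z ⊔ ℂ ∙ x) :=
  hZ.sup_ortho (HasDim.span_singleton hx) h

theorem not_mem_of_isOrtho {Z : Submodule ℂ H} {x : H} (hx : x ≠ 0) (h : Z ⟂ ℂ ∙ x) : x ∉ Z := by
  intro hZ
  exact hx (inner_self_eq_zero.1 (h.inner_eq hZ (mem_span_singleton_self x)))

theorem eq_of_mem_star {m : ℕ} {Z X Y : Submodule ℂ H} (hZ : HasDim m Z) (hX : HasDim (m + 1) X)
    (hY : HasDim (m + 1) Y) (h1 : Z ≤ X) (h2 : Z ≤ Y) : X = Y ∨ Adj m X Y := by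
  by_cases h : X = Y
  · exact Or.inl h
  · exact Or.inr (Adj.of_common hX hY h hZ h1 h2)

namespace PreservesOrthoAdj

variable {m : ℕ} {F : Submodule ℂ H → Submodule ℂ H}

/-- If the star of `Z` went into a top with sum `W`, every `F Y` with `Y ⟂ Z` would be orthogonal to
`W`; but some such `Y` meets an element of the star nontrivially. -/
theorem exists_star (hn : ((2 * (m + 2) + 1 : ℕ) : Cardinal) ≤ Module.rank ℂ H)
    (hF : PreservesOrthoAdj (m + 1) F) {Z : Submodule ℂ H} (hZ : HasDim (m + 1) Z) :
    ∃ Q, HasDim (m + 1) Q ∧ ∀ X, HasDim (m + 2) X → Z ≤ X → Q ≤ F X := by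
  obtain ⟨R, hRZ, hR⟩ := hZ.exists_ortho hn (p := 2) (by omega)
  have pair : ∀ R, R ⟂ Z → HasDim 2 R → ∃ X Y, Z ≤ X ∧ Z ≤ Y ∧ X ≤ Z ⊔ R ∧ Y ≤ Z ⊔ R ∧
      Adj (m + 1) X Y := by
    intro R hRZ hR
    obtain ⟨x, hx, y, hy, hy0, hxy⟩ := hR.exists_span_pair le_rfl
    have hyZ : Z ⟂ ℂ ∙ y := hRZ.symm.mono_right ((span_singleton_le_iff_mem _ _).2 hy)
    refine ⟨Z ⊔ ℂ ∙ x, Z ⊔ ℂ ∙ y, le_sup_left, le_sup_left,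
      sup_le_sup_left ((span_singleton_le_iff_mem _ _).2 hx) _,
      sup_le_sup_left ((span_singleton_le_iff_mem _ _).2 hy) _,
      Adj.sup_span hZ (not_mem_of_isOrtho hy0 hyZ) fun h => ?_⟩
    obtain ⟨z, hz, w, hw, e⟩ := mem_sup.1 h
    have hwR : w ∈ R := (span_singleton_le_iff_mem _ _).2 hy hw
    have hzR : z ∈ R := by
      have : z = x - w := by rw [← e]; abel
      exact this ▸ R.sub_mem hx hwR
    have hz0 : z = 0 := inner_self_eq_zero.1 (hRZ.inner_eq hzR hz)
    rw [hz0, zero_add] at e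
    exact hxy (e ▸ hw)
  obtain ⟨X₁, X₂, h1, h2, -, -, h12⟩ := pair R hRZ hR
  have hcl : ∀ A ∈ {A | ∃ X, HasDim (m + 2) X ∧ Z ≤ X ∧ A = F X},
      ∀ B ∈ {A | ∃ X, HasDim (m + 2) X ∧ Z ≤ X ∧ A = F X}, A = B ∨ Adj (m + 1) A B := by
    rintro _ ⟨X, hX, hZX, rfl⟩ _ ⟨Y, hY, hZY, rfl⟩
    rcases eq_of_mem_star hZ hX hY hZX hZY with rfl | h
    · exact Or.inl rfl
    · exact Or.inr (hF.adj h)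
  rcases (hF.adj h12).star_or_top (S := {A | ∃ X, HasDim (m + 2) X ∧ Z ≤ X ∧ A = F X})
    ⟨X₁, h12.left, h1, rfl⟩ ⟨X₂, h12.right, h2, rfl⟩ hcl with h | h
  · exact ⟨_, (hF.adj h12).inter, fun X hX hZX => h _ ⟨X, hX, hZX, rfl⟩⟩
  exfalso
  have hW := (hF.adj h12).sup
  set W := F X₁ ⊔ F X₂
  have hYW : ∀ Y, HasDim (m + 2) Y → Y ⟂ Z → F Y ⟂ W := by
    intro Y hY hYZ
    -- This needs exactly `(m + 2) + (m + 1) + 2 = 2 * (m + 2) + 1` dimensions. Two elements of the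
    -- star inside `Z ⊔ S` are orthogonal to `Y`, and their images already span `W`.
    obtain ⟨S, hS, hS'⟩ := (hY.sup_ortho hZ hYZ).exists_ortho hn (p := 2) (by omega)
    rw [isOrtho_sup_right] at hS
    obtain ⟨A, B, hA, hB, hA', hB', hAB⟩ := pair S hS.2 hS'
    have hYS : Y ⟂ Z ⊔ S := isOrtho_sup_right.2 ⟨hYZ, hS.1.symm⟩
    have e : F A ⊔ F B = W := (hF.adj hAB).sup.eq_of_le hW
      (sup_le (h _ ⟨A, hAB.left, hA, rfl⟩) (h _ ⟨B, hAB.right, hB, rfl⟩)) le_rfl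
    rw [← e, isOrtho_sup_right]
    exact ⟨hF.ortho hY hAB.left (hYS.mono_right hA'), hF.ortho hY hAB.right (hYS.mono_right hB')⟩
  obtain ⟨Y, hYZ, hY⟩ := hZ.exists_ortho hn (p := m + 2) (by omega)
  obtain ⟨x, hx, hx0⟩ := Submodule.exists_mem_ne_zero_of_ne_bot (hY.ne_bot (by omega))
  have hxY : ℂ ∙ x ≤ Y := (span_singleton_le_iff_mem _ _).2 hx
  have hX := hZ.sup_span_isOrtho hx0 (hYZ.symm.mono_right hxY)
  obtain ⟨a, -, ha⟩ := hX.mono (inf_le_left : (Z ⊔ ℂ ∙ x) ⊓ Y ≤ _)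
  obtain ⟨b, -, hb⟩ := (hF.dim hX).mono (inf_le_left : F (Z ⊔ ℂ ∙ x) ⊓ F Y ≤ _)
  have h3 := hF.le_inter hX hY ha hb
  have h4 := (HasDim.span_singleton hx0).le_dim ha (le_inf le_sup_right hxY)
  have h5 : F Y ⟂ F (Z ⊔ ℂ ∙ x) := (hYW Y hY hYZ).mono_right (h _ ⟨_, hX, le_sup_left, rfl⟩)
  exact hb.ne_bot (by omega) h5.symm.disjoint.eq_bot

/-- A map preserving orthogonality and adjacency descends to subspaces of smaller dimension. -/
theorem exists_descent (hn : ((2 * (m + 2) + 1 : ℕ) : Cardinal) ≤ Module.rank ℂ H)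
    (hF : PreservesOrthoAdj (m + 1) F) : ∃ G : Submodule ℂ H → Submodule ℂ H,
      PreservesOrthoAdj m G ∧
      ∀ Z X, HasDim (m + 1) Z → HasDim (m + 2) X → Z ≤ X → G Z ≤ F X := by
  have hex : ∀ Z : Submodule ℂ H, ∃ Q, HasDim (m + 1) Z →
      HasDim (m + 1) Q ∧ ∀ X, HasDim (m + 2) X → Z ≤ X → Q ≤ F X := by
    intro Z
    by_cases hZ : HasDim (m + 1) Z
    · obtain ⟨Q, hQ⟩ := hF.exists_star hn hZ
      exact ⟨Q, fun _ => hQ⟩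
    · exact ⟨⊥, fun h => absurd h hZ⟩
  choose G hG using hex
  refine ⟨G, ⟨fun hZ => (hG _ hZ).1, ?_, ?_⟩, fun Z X hZ hX h => (hG Z hZ).2 X hX h⟩
  · intro Z Z' hZ hZ' h
    obtain ⟨X, hZX, hXZ', hX⟩ := hZ.exists_extension hn hZ' h (p := m + 2) (by omega) (by omega)
    obtain ⟨X', hZX', hXX', hX'⟩ := hZ'.exists_extension hn hX hXZ'.symm (p := m + 2)
      (by omega) (by omega)
    exact (hF.ortho hX hX' hXX'.symm).mono ((hG Z hZ).2 X hX hZX) ((hG Z' hZ').2 X' hX' hZX')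
  intro Z Z' h
  have hQ := (hG Z h.left).1
  have hX₀ := h.sup
  refine Adj.of_sup_le hQ (hG Z' h.right).1 (fun hQQ => ?_) (hF.dim hX₀)
    ((hG Z h.left).2 _ hX₀ le_sup_left) ((hG Z' h.right).2 _ hX₀ le_sup_right)
  have hQX₀ := (hG Z h.left).2 _ hX₀ le_sup_left
  have hN := h.inter
  -- Suppose `G Z = G Z'`. This subspace and `G (Z ⊓ Z' ⊔ ℂ ∙ x)` both lie in `F (Z ⊔ ℂ ∙ x) ⊓ F (Z'
  -- ⊔ ℂ ∙ x)`, which has the same dimension as each.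
  have key : ∀ x, x ∉ Z ⊔ Z' → G (Z ⊓ Z' ⊔ ℂ ∙ x) = G Z := by
    intro x hx
    have hxZ : x ∉ Z := fun h' => hx ((le_sup_left : Z ≤ Z ⊔ Z') h')
    have hxZ' : x ∉ Z' := fun h' => hx ((le_sup_right : Z' ≤ Z ⊔ Z') h')
    have d1 := h.left.sup_span hxZ
    have d2 := h.right.sup_span hxZ'
    have d3 := hN.sup_span (fun h' => hxZ h'.1)
    have h3 : Z ⊔ ℂ ∙ x ≠ Z' ⊔ ℂ ∙ x := by
      intro e
      have h4 : Z ⊔ Z' ≤ Z ⊔ ℂ ∙ x := sup_le le_sup_left (e ▸ le_sup_left)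
      have h5 := hX₀.eq_of_le d1 h4 le_rfl
      exact hx (h5 ▸ (le_sup_right : ℂ ∙ x ≤ Z ⊔ ℂ ∙ x) (mem_span_singleton_self x))
    have hadj : Adj (m + 1) (Z ⊔ ℂ ∙ x) (Z' ⊔ ℂ ∙ x) :=
      Adj.of_common d1 d2 h3 d3 (sup_le_sup_right inf_le_left _) (sup_le_sup_right inf_le_right _)
    have e1 := (hG _ d3).1.eq_of_le (hF.adj hadj).inter
      (le_inf ((hG _ d3).2 _ d1 (sup_le_sup_right inf_le_left _))
        ((hG _ d3).2 _ d2 (sup_le_sup_right inf_le_right _))) le_rfl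
    have e2 := hQ.eq_of_le (hF.adj hadj).inter
      (le_inf ((hG _ h.left).2 _ d1 le_sup_left)
        (hQQ ▸ (hG _ h.right).2 _ d2 le_sup_left)) le_rfl
    exact e1.trans e2.symm
  -- The contradiction: `F (Z ⊓ Z' ⊔ R)` contains the hyperplane `G Z` and meets `F W` in dimension
  -- at least 2, so `F W` meets `G Z`, although `F W ⟂ F (Z ⊔ Z')`.
  obtain ⟨W, hWX, hW⟩ := hX₀.exists_ortho hn (p := m + 2) (by omega)
  obtain ⟨R, -, hRW, hR⟩ := HasDim.bot.exists_between hW bot_le (m := 2) (by omega) (by omega)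
  have hNR : Z ⊓ Z' ⟂ R := (hWX.mono hRW (inf_le_left.trans le_sup_left)).symm
  have hX := hN.sup_ortho hR hNR
  obtain ⟨x, hx, hx0⟩ := Submodule.exists_mem_ne_zero_of_ne_bot (hR.ne_bot (by omega))
  have hxs : ℂ ∙ x ≤ R := (span_singleton_le_iff_mem _ _).2 hx
  have hx' : x ∉ Z ⊔ Z' :=
    not_mem_of_isOrtho hx0 (hWX.mono_left (hxs.trans hRW)).symm
  have hQX : G Z ≤ F (Z ⊓ Z' ⊔ R) := by
    rw [← key x hx']
    exact (hG _ (hN.sup_span fun h' => hx' ((le_sup_left : Z ≤ Z ⊔ Z') h'.1))).2 _ hX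
      (sup_le_sup_left hxs _)
  obtain ⟨a, -, ha⟩ := hX.mono (inf_le_left : (Z ⊓ Z' ⊔ R) ⊓ W ≤ _)
  obtain ⟨b, -, hb⟩ := (hF.dim hX).mono (inf_le_left : F (Z ⊓ Z' ⊔ R) ⊓ F W ≤ _)
  have h3 := hF.le_inter hX hW ha hb
  have h4 := hR.le_dim ha (le_inf le_sup_right hRW)
  obtain ⟨s, i, hs, hi, e⟩ := hb.sup_inf hQ
  have h5 := hs.le_dim (hF.dim hX) (sup_le inf_le_left hQX)
  have h6 : F W ⟂ G Z := (hF.ortho hW hX₀ hWX).mono_right hQX₀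
  exact hi.ne_bot (by omega) (eq_bot_iff.2
    ((inf_le_inf_right _ inf_le_right).trans h6.disjoint.eq_bot.le))

end PreservesOrthoAdj

/-! ### Recognizing linear and conjugate-linear isometries. -/

/-- `U` is a linear or conjugate-linear isometry, with companion automorphism `σ`. -/
structure IsSemiIsometry {K : Type*} [NormedAddCommGroup K] [InnerProductSpace ℂ K]
    (σ : ℂ →+* ℂ) (U : K → H) : Prop where
  id_or_conj : σ = RingHom.id ℂ ∨ σ = starRingEnd ℂ
  map_add : ∀ v w, U (v + w) = U v + U w
  map_smul : ∀ (c : ℂ) v, U (c • v) = σ c • U v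
  norm_map : ∀ v, ‖U v‖ = ‖v‖

/-- Commuting with conjugation makes `σ` map reals to reals, and the identity is the only ring
endomorphism of `ℝ`; no continuity is needed. -/
theorem ringHom_eq_id_or_conj (σ : ℂ →+* ℂ) (h : ∀ z, σ (starRingEnd ℂ z) = starRingEnd ℂ (σ z)) :
    σ = RingHom.id ℂ ∨ σ = starRingEnd ℂ := by
  have h1 : ∀ r : ℝ, ((σ r).re : ℂ) = σ r := by
    intro r
    rw [← Complex.conj_eq_iff_re, ← h, Complex.conj_ofReal]
  let τ : ℝ →+* ℝ :=
    { toFun := fun r => (σ r).re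
      map_one' := by simp
      map_zero' := by simp
      map_add' := fun x y => by simp
      map_mul' := fun x y => by
        apply Complex.ofReal_injective
        rw [h1]
        push_cast
        rw [h1, h1, map_mul] }
  have h2 : ∀ r : ℝ, σ r = r := by
    intro r
    have : τ r = r := by rw [Subsingleton.elim τ (RingHom.id ℝ)]; rfl
    rw [← h1]
    exact congrArg _ this
  let f : ℂ →ₐ[ℝ] ℂ := { σ with commutes' := h2 }
  rcases Complex.real_algHom_eq_id_or_conj f with h3 | h3
  · left
    ext z
    exact congrArg (fun g : ℂ →ₐ[ℝ] ℂ => g z) h3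
  · right
    ext z
    exact congrArg (fun g : ℂ →ₐ[ℝ] ℂ => g z) h3

/-- Linear independence of two vectors. -/
def IsIndep (v w : H) : Prop := ∀ s t : ℂ, s • v + t • w = 0 → s = 0 ∧ t = 0

theorem IsIndep.of_inner {e x w : H} (h1 : inner ℂ e x = (1 : ℂ)) (h2 : inner ℂ e w = (0 : ℂ))
    (hw : w ≠ 0) : IsIndep x w := by
  intro s t h
  have h3 := congrArg (inner ℂ e) h
  simp only [inner_add_right, inner_smul_right, h1, h2, inner_zero_right, mul_one, mul_zero,
    add_zero] at h3
  subst h3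
  simpa [hw] using h

section Semilinear

variable {K : Type*} [NormedAddCommGroup K] [InnerProductSpace ℂ K]

/-- The auxiliary orthogonal vector from `hK` extends additivity to dependent vectors and shows that
the scalar of `hsmul` does not depend on the vector. The products `-1` then fix norms and make `σ`
commute with conjugation. -/
theorem exists_isSemiIsometry (hK : ∀ v w : K, ∃ z : K, z ≠ 0 ∧ inner ℂ v z = (0 : ℂ) ∧
      inner ℂ w z = (0 : ℂ)) (U : K → H) (h0 : U 0 = 0)
    (hortho : ∀ v w : K, inner ℂ v w = (0 : ℂ) → inner ℂ (U v) (U w) = (0 : ℂ))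
    (hneg : ∀ v w : K, inner ℂ v w = (-1 : ℂ) → inner ℂ (U v) (U w) = (-1 : ℂ))
    (hadd : ∀ v w : K, IsIndep v w → U (v + w) = U v + U w)
    (hne : ∀ v, v ≠ 0 → U v ≠ 0)
    (hsmul : ∀ (c : ℂ) v, v ≠ 0 → ∃ d : ℂ, U (c • v) = d • U v) :
    ∃ σ, IsSemiIsometry σ U := by
  have indep : ∀ v z : K, v ≠ 0 → z ≠ 0 → inner ℂ v z = (0 : ℂ) → IsIndep v z := by
    intro v z hv hz h s t hst
    have h1 := congrArg (inner ℂ v) hst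
    simp only [inner_add_right, inner_smul_right, h, inner_zero_right, mul_zero, add_zero,
      mul_eq_zero, inner_self_eq_zero, hv, or_false] at h1
    subst h1
    simpa [hz] using hst
  have hadd' : ∀ v w, U (v + w) = U v + U w := by
    intro v w
    by_cases hv : v = 0
    · simp [hv, h0]
    by_cases hvw : v + w = 0
    · obtain ⟨z, hz, h1, -⟩ := hK v v
      obtain rfl : w = -v := (neg_eq_of_add_eq_zero_right hvw).symm
      have e1 := hadd v (-v + z) (by
        intro s t hst
        have := indep v z hv hz h1 (s - t) t (by rw [← hst]; module)
        refine ⟨?_, this.2⟩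
        rw [← sub_eq_zero.1 this.1] at this
        exact (sub_eq_zero.1 this.1).trans (by simpa using this.2))
      have e2 := hadd (-v) z (indep _ _ (neg_ne_zero.2 hv) hz (by simp [h1]))
      rw [add_neg_cancel_left, e2] at e1
      rw [hvw, h0]
      have : U z = (U v + U (-v)) + U z := by rw [add_assoc]; exact e1
      exact (add_eq_right.1 this.symm).symm
    obtain ⟨z, hz, h1, h2⟩ := hK v w
    have e1 := hadd (v + w) z (indep _ _ hvw hz (by rw [inner_add_left, h1, h2, add_zero]))
    have e2 : U (w + z) = U w + U z := by
      by_cases hw : w = 0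
      · simp [hw, h0]
      · exact hadd _ _ (indep _ _ hw hz h2)
    have e3 := hadd v (w + z) (by
      intro s t hst
      have h3 := congrArg (inner ℂ z) hst
      rw [inner_eq_zero_symm] at h1 h2
      simp only [smul_add, inner_add_right, inner_smul_right, h1, h2, inner_zero_right, mul_zero,
        zero_add, mul_eq_zero, inner_self_eq_zero, hz, or_false] at h3
      subst h3
      simpa [hv] using hst)
    rw [← add_assoc, e1, e2, ← add_assoc] at e3
    exact add_right_cancel e3
  have hU1 : ∀ u : K, ‖u‖ = 1 → inner ℂ (U u) (U u) = (1 : ℂ) := by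
    intro u hu
    have h1 : U (-u) = - U u := by
      rw [eq_neg_iff_add_eq_zero, ← hadd', neg_add_cancel, h0]
    have h2 := hneg u (-u) (by simp [inner_self_eq_norm_sq_to_K, hu])
    rw [h1, inner_neg_right] at h2
    exact neg_injective h2
  obtain ⟨u, hu, -, -⟩ := hK 0 0
  have hσex : ∀ c : ℂ, ∃ d : ℂ, ∀ v, U (c • v) = d • U v := by
    intro c
    obtain ⟨d, hd⟩ := hsmul c u hu
    -- For orthogonal `v`, `z`, the components of `U (c • (v + z))` along `U v` and `U z` carry the
    -- same scalar.
    have key : ∀ v z : K, v ≠ 0 → z ≠ 0 → inner ℂ v z = (0 : ℂ) → ∀ d : ℂ,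
        U (c • v) = d • U v → U (c • z) = d • U z := by
      intro v z hv hz hvz d hd
      obtain ⟨s, hs⟩ := hsmul c (v + z) (fun h => by
        have := indep v z hv hz hvz 1 1 (by simpa using h)
        exact one_ne_zero this.1)
      obtain ⟨d', hd'⟩ := hsmul c z hz
      rw [smul_add, hadd', hadd', hd, hd'] at hs
      have o := hortho v z hvz
      have o' := inner_eq_zero_symm.1 o
      have h1 := congrArg (inner ℂ (U v)) hs
      have h2 := congrArg (inner ℂ (U z)) hs
      simp only [smul_add, inner_add_right, inner_smul_right, o, o', mul_zero, add_zero,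
        zero_add] at h1 h2
      have h3 := mul_right_cancel₀ (mt inner_self_eq_zero.1 (hne v hv)) h1
      have h4 := mul_right_cancel₀ (mt inner_self_eq_zero.1 (hne z hz)) h2
      rw [hd', h4, h3]
    refine ⟨d, fun v => ?_⟩
    by_cases hv : v = 0
    · simp [hv, h0]
    obtain ⟨z, hz, h1, h2⟩ := hK u v
    exact key z v hz hv (inner_eq_zero_symm.1 h2) d (key u z hu hz h1 d hd)
  choose s hs using hσex
  have cancel : ∀ {c d : ℂ}, c • U u = d • U u → c = d :=
    fun h => smul_left_injective ℂ (hne u hu) h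
  let σ : ℂ →+* ℂ :=
    { toFun := s
      map_one' := cancel (by rw [← hs, one_smul, one_smul])
      map_zero' := cancel (by rw [← hs, zero_smul, zero_smul, h0])
      map_add' := fun x y => cancel (by rw [← hs, add_smul, add_smul, hadd', hs, hs])
      map_mul' := fun x y => cancel (by rw [← hs, mul_smul, mul_smul, hs, hs]) }
  have hσ : ∀ c v, U (c • v) = σ c • U v := hs
  obtain ⟨w, hw⟩ : ∃ w : K, ‖w‖ = 1 := ⟨_, norm_smul_inv_norm (𝕜 := ℂ) hu⟩
  have hconj : ∀ z, σ (starRingEnd ℂ z) = starRingEnd ℂ (σ z) := by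
    intro z
    by_cases hz : z = 0
    · simp [hz]
    have hz' : starRingEnd ℂ z ≠ 0 := by simpa using hz
    -- The second multiple of the unit vector `w` is chosen to make the inner product `-1`.
    have h1 := hneg (z • w) ((-(starRingEnd ℂ z)⁻¹) • w) (by
      rw [inner_smul_left, inner_smul_right, inner_self_eq_norm_sq_to_K, hw]
      simp [hz'])
    rw [hσ, hσ, inner_smul_left, inner_smul_right, hU1 w hw, mul_one, map_neg, map_inv₀,
      mul_neg, neg_inj] at h1
    have h2 : σ (starRingEnd ℂ z) ≠ 0 := (map_ne_zero σ).2 hz'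
    field_simp at h1
    exact h1.symm
  have hic := ringHom_eq_id_or_conj σ hconj
  refine ⟨σ, hic, hadd', hσ, fun v => ?_⟩
  by_cases hv : v = 0
  · simp [hv, h0]
  have h1 := norm_smul_inv_norm (𝕜 := ℂ) hv
  have h2 : v = (‖v‖ : ℂ) • (((‖v‖⁻¹ : ℝ) : ℂ) • v) := by
    have : (‖v‖ : ℂ) ≠ 0 := by simpa using hv
    rw [smul_smul]
    push_cast
    rw [mul_inv_cancel₀ this, one_smul]
  have h3 : ‖U (((‖v‖⁻¹ : ℝ) : ℂ) • v)‖ = 1 := by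
    have h5 : ‖U (((‖v‖⁻¹ : ℝ) : ℂ) • v)‖ ^ 2 = 1 := by
      rw [← inner_self_eq_norm_sq (𝕜 := ℂ), hU1 _ (by simpa using h1), RCLike.one_re]
    exact (pow_eq_one_iff_of_nonneg (norm_nonneg _) two_ne_zero).1 h5
  have h6 : ‖σ (‖v‖ : ℂ)‖ = ‖v‖ := by
    rcases hic with h | h <;> simp [h]
  conv_lhs => rw [h2]
  rw [hσ, norm_smul, h6, h3, mul_one]

end Semilinear

theorem HasDim.mem_span_singleton {A : Submodule ℂ H} (hA : HasDim 1 A) {x y : H} (hx : x ∈ A)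
    (hx0 : x ≠ 0) (hy : y ∈ A) : ∃ c : ℂ, y = c • x := by
  have h := (HasDim.span_singleton hx0).eq_of_le hA ((span_singleton_le_iff_mem _ _).2 hx) le_rfl
  rw [← h, Submodule.mem_span_singleton] at hy
  obtain ⟨c, hc⟩ := hy
  exact ⟨c, hc.symm⟩

/-! ### Reconstruction of the isometry from its action on lines. -/

/-- A map of lines that preserves orthogonality, independence and coplanarity is induced by
a linear or conjugate-linear isometry. -/
theorem exists_isSemiIsometry_of_lines (hn : ((5 : ℕ) : Cardinal) ≤ Module.rank ℂ H)
    (g : H → Submodule ℂ H) (hdim : ∀ v, v ≠ 0 → HasDim 1 (g v))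
    (hortho : ∀ v w, v ≠ 0 → w ≠ 0 → inner ℂ v w = (0 : ℂ) → g v ⟂ g w)
    (hspan : ∀ v w u, u ≠ 0 → IsIndep v w → u ∈ (ℂ ∙ v) ⊔ ℂ ∙ w → g u ≤ g v ⊔ g w)
    (hindep : ∀ v w, IsIndep v w → g v ⊓ g w = ⊥)
    (hsmul : ∀ (c : ℂ) v, c ≠ 0 → g (c • v) = g v) :
    ∃ (σ : ℂ →+* ℂ) (U : H → H), IsSemiIsometry σ U ∧ ∀ v, v ≠ 0 → U v ∈ g v := by
  obtain ⟨e', he0', -⟩ := HasDim.bot.exists_orthogonal hn (by omega)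
  obtain ⟨e, he⟩ : ∃ e : H, ‖e‖ = 1 := ⟨_, norm_smul_inv_norm (𝕜 := ℂ) he0'⟩
  have he0 : e ≠ 0 := by rintro rfl; simp at he
  obtain ⟨a', ha', ha0'⟩ := Submodule.exists_mem_ne_zero_of_ne_bot ((hdim e he0).ne_bot one_ne_zero)
  obtain ⟨a, ha, hae⟩ : ∃ a : H, ‖a‖ = 1 ∧ a ∈ g e :=
    ⟨_, norm_smul_inv_norm (𝕜 := ℂ) ha0', (g e).smul_mem _ ha'⟩
  have ha0 : a ≠ 0 := by rintro rfl; simp at ha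
  have hee : inner ℂ e e = (1 : ℂ) := by simp [inner_self_eq_norm_sq_to_K, he]
  have haa : inner ℂ a a = (1 : ℂ) := by simp [inner_self_eq_norm_sq_to_K, ha]
  let K : Submodule ℂ H := (ℂ ∙ e)ᗮ
  have hKe : ∀ v : K, inner ℂ e (v : H) = (0 : ℂ) :=
    fun v => mem_orthogonal_singleton_iff_inner_right.1 v.2
  have hev : ∀ v : K, inner ℂ e (e + v : H) = (1 : ℂ) := fun v => by
    rw [inner_add_right, hKe, hee, add_zero]
  have hev0 : ∀ v : K, (e + v : H) ≠ 0 := fun v h => by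
    have := hev v
    rw [h, inner_zero_right] at this
    exact zero_ne_one this
  have hne : ∀ v : K, v ≠ 0 → (v : H) ≠ 0 := fun v hv h => hv (Subtype.ext h)
  have hag : ∀ v : K, v ≠ 0 → ∀ x ∈ g v, inner ℂ a x = (0 : ℂ) := fun v hv x hx =>
    (hortho e v he0 (hne v hv) (hKe v)).inner_eq hae hx
  -- A spanning vector of `g (e + v)` lies in `g e ⊔ g v`; independence makes both components
  -- nonzero, so its `g e`-component can be scaled to `a`.
  have hex : ∀ v : K, ∃ u : H, (v = 0 → u = 0) ∧
      (v ≠ 0 → u ∈ g v ∧ u ≠ 0) ∧ a + u ∈ g (e + v) := by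
    intro v
    by_cases hv : v = 0
    · subst hv
      exact ⟨0, fun _ => rfl, fun h => absurd rfl h, by simpa using hae⟩
    have h1 := hspan e v (e + v) (hev0 v) (IsIndep.of_inner hee (hKe v) (hne v hv))
      (add_mem_sup (mem_span_singleton_self _) (mem_span_singleton_self _))
    obtain ⟨y, hy, hy0⟩ := Submodule.exists_mem_ne_zero_of_ne_bot
      ((hdim _ (hev0 v)).ne_bot one_ne_zero)
    obtain ⟨b, hb, u, hu, rfl⟩ := mem_sup.1 (h1 hy)
    obtain ⟨s, rfl⟩ := (hdim e he0).mem_span_singleton hae ha0 hb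
    have hs : s ≠ 0 := by
      rintro rfl
      rw [zero_smul, zero_add] at hy hy0
      have := hindep _ _ (IsIndep.of_inner (hev v) (hKe v) (hne v hv))
      exact hy0 ((mem_bot ℂ).1 (this ▸ (⟨hy, hu⟩ : u ∈ g (e + v) ⊓ g v)))
    have hu' : a + s⁻¹ • u ∈ g (e + v) := by
      have := (g (e + v)).smul_mem s⁻¹ hy
      rwa [smul_add, smul_smul, inv_mul_cancel₀ hs, one_smul] at this
    refine ⟨s⁻¹ • u, fun h => absurd h hv, fun _ => ⟨(g v).smul_mem _ hu, fun h => ?_⟩, hu'⟩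
    rw [h, add_zero] at hu'
    have h2 : IsIndep e (e + v : H) := by
      intro p q hpq
      have h3 := IsIndep.of_inner hee (hKe v) (hne v hv) (p + q) q (by rw [← hpq]; module)
      exact ⟨by simpa [h3.2] using h3.1, h3.2⟩
    exact ha0 ((mem_bot ℂ).1 (hindep _ _ h2 ▸ (⟨hae, hu'⟩ : a ∈ g e ⊓ g (e + v))))
  choose U hU0 hUg hUe using hex
  have haU : ∀ v : K, inner ℂ a (U v) = (0 : ℂ) := by
    intro v
    by_cases hv : v = 0
    · rw [hU0 v hv, inner_zero_right]
    · exact hag v hv _ (hUg v hv).1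
  obtain ⟨σ, hσ⟩ : ∃ σ, IsSemiIsometry σ U := by
    refine exists_isSemiIsometry ?_ U (hU0 0 rfl) ?_ ?_ ?_ (fun v hv => (hUg v hv).2) ?_
    · intro v w
      have h1 : ∃ d ≤ 3, HasDim d (span ℂ {e, (v : H), (w : H)}) := by
        have : ({e, (v : H), (w : H)} : Set H).Finite := by simp
        refine ⟨_, ?_, FiniteDimensional.span_of_finite ℂ this, rfl⟩
        classical
        have := finrank_span_finset_le_card (R := ℂ) ({e, (v : H), (w : H)} : Finset H)
        push_cast at this
        exact this.trans Finset.card_le_three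
      obtain ⟨d, hd, h1⟩ := h1
      obtain ⟨z, hz, h2⟩ := h1.exists_orthogonal hn (by omega)
      have h3 : ∀ x ∈ ({e, (v : H), (w : H)} : Set H), inner ℂ x z = (0 : ℂ) := fun x hx =>
        h2.inner_eq (subset_span hx) (mem_span_singleton_self z)
      refine ⟨⟨z, mem_orthogonal_singleton_iff_inner_right.2 (h3 e (by simp))⟩,
        fun h => hz (congrArg Subtype.val h), h3 v (by simp), h3 w (by simp)⟩
    · intro v w h
      by_cases hv : v = 0
      · rw [hU0 v hv, inner_zero_left]
      by_cases hw : w = 0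
      · rw [hU0 w hw, inner_zero_right]
      exact (hortho v w (hne v hv) (hne w hw) h).inner_eq (hUg v hv).1 (hUg w hw).1
    · intro v w h
      have h1 : inner ℂ (e + v : H) (e + w : H) = (0 : ℂ) := by
        rw [inner_add_left, inner_add_right, inner_add_right, hee, hKe w,
          inner_eq_zero_symm.1 (hKe v)]
        change 1 + 0 + (0 + inner ℂ v w) = (0 : ℂ)
        rw [h]; ring
      have h2 := (hortho _ _ (hev0 v) (hev0 w) h1).inner_eq (hUe v) (hUe w)
      rw [inner_add_left, inner_add_right, inner_add_right, haa, haU w,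
        inner_eq_zero_symm.1 (haU v), add_zero, zero_add] at h2
      exact eq_neg_of_add_eq_zero_right h2
    · intro v w h
      have hv : v ≠ 0 := by
        rintro rfl
        exact one_ne_zero (h 1 0 (by simp)).1
      have hw : w ≠ 0 := by
        rintro rfl
        exact one_ne_zero (h 0 1 (by simp)).2
      have h' : IsIndep (v : H) (w : H) := fun s t hst => h s t (Subtype.ext hst)
      -- Using this with `v` and `w` exchanged as well, the two expressions for `U (v + w)` differ
      -- by a vector of `g v ⊓ g w = ⊥`.
      have key : ∀ v w : K, w ≠ 0 → ∃ y ∈ g w, U (v + w) = U v + y := by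
        intro v w hw
        have h1 := hspan (e + v) w (e + (v + w : K)) (hev0 _)
          (IsIndep.of_inner (hev v) (hKe w) (hne w hw)) (by
            rw [coe_add, ← add_assoc]
            exact add_mem_sup (mem_span_singleton_self _) (mem_span_singleton_self _))
        obtain ⟨b, hb, y, hy, hby⟩ := mem_sup.1 (h1 (hUe (v + w)))
        have hne' : a + U v ≠ 0 := fun h => by
          have := congrArg (inner ℂ a) h
          rw [inner_add_right, haa, haU, inner_zero_right, add_zero] at this
          exact one_ne_zero this
        obtain ⟨s, rfl⟩ := (hdim _ (hev0 v)).mem_span_singleton (hUe v) hne' hb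
        have h2 := congrArg (inner ℂ a) hby
        rw [inner_add_right, inner_smul_right, inner_add_right, inner_add_right, haa, haU, haU,
          hag w hw y hy] at h2
        obtain rfl : s = 1 := by simpa using h2
        refine ⟨y, hy, ?_⟩
        rw [one_smul, add_assoc] at hby
        exact (add_left_cancel hby).symm
      obtain ⟨y, hy, e1⟩ := key v w hw
      obtain ⟨x, hx, e2⟩ := key w v hv
      have h3 : U v - x = U w - y := by
        rw [add_comm w v, e1] at e2
        rw [sub_eq_sub_iff_add_eq_add]; exact e2
      have h4 : U v - x ∈ g v ⊓ g w :=
        ⟨(g v).sub_mem (hUg v hv).1 hx, h3 ▸ (g w).sub_mem (hUg w hw).1 hy⟩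
      rw [hindep _ _ h', mem_bot, h3, sub_eq_zero] at h4
      rw [e1, h4]
    · intro c v hv
      by_cases hc : c = 0
      · exact ⟨0, by rw [hc, zero_smul, zero_smul, hU0 0 rfl]⟩
      have h1 := (hUg (c • v) (smul_ne_zero hc hv)).1
      rw [coe_smul, hsmul c _ hc] at h1
      exact (hdim _ (hne v hv)).mem_span_singleton (hUg v hv).1 (hUg v hv).2 h1
  have hp : ∀ x : H, x - (inner ℂ e x : ℂ) • e ∈ K := fun x =>
    mem_orthogonal_singleton_iff_inner_right.2 (by
      rw [inner_sub_right, inner_smul_right, hee, mul_one, sub_self])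
  let p : H → K := fun x => ⟨x - (inner ℂ e x : ℂ) • e, hp x⟩
  have hpx : ∀ x, x = (inner ℂ e x : ℂ) • e + (p x : H) := fun x => (add_sub_cancel _ _).symm
  have hσn : ∀ c, ‖σ c‖ = ‖c‖ := fun c => by
    rcases hσ.id_or_conj with h | h <;> simp [h]
  refine ⟨σ, fun x => σ (inner ℂ e x) • a + U (p x), ⟨hσ.id_or_conj, ?_, ?_, ?_⟩, ?_⟩
  · intro v w
    have : p (v + w) = p v + p w := Subtype.ext (by
      change v + w - _ = v - _ + (w - _)
      rw [inner_add_right]; module)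
    rw [this, hσ.map_add, inner_add_right, map_add]
    module
  · intro c v
    have : p (c • v) = c • p v := Subtype.ext (by
      change c • v - _ = c • (v - _)
      rw [inner_smul_right]; module)
    rw [this, hσ.map_smul, inner_smul_right, map_mul]
    module
  · intro v
    have h1 : ‖σ (inner ℂ e v) • a + U (p v)‖ * ‖σ (inner ℂ e v) • a + U (p v)‖ = ‖v‖ * ‖v‖ := by
      conv_rhs => rw [hpx v]
      rw [norm_add_sq_eq_norm_sq_add_norm_sq_of_inner_eq_zero (𝕜 := ℂ),
        norm_add_sq_eq_norm_sq_add_norm_sq_of_inner_eq_zero (𝕜 := ℂ), norm_smul, norm_smul,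
        hσn, ha, he, hσ.norm_map]
      · rfl
      · rw [inner_smul_left, hKe, mul_zero]
      · rw [inner_smul_left, haU, mul_zero]
    exact (mul_self_inj (norm_nonneg _) (norm_nonneg _)).1 h1
  · intro v hv
    by_cases hc : (inner ℂ e v : ℂ) = 0
    · have h1 : (p v : H) = v := by
        conv_rhs => rw [hpx v]
        rw [hc, zero_smul, zero_add]
      have h2 : p v ≠ 0 := fun h => hv (by rw [← h1, h]; rfl)
      have h3 := (hUg _ h2).1
      rw [h1] at h3
      simpa [hc] using h3
    · have h1 : v = (inner ℂ e v : ℂ) • (e + ((inner ℂ e v : ℂ)⁻¹ • p v : K) : H) := by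
        conv_lhs => rw [hpx v]
        rw [smul_add, coe_smul, smul_smul, mul_inv_cancel₀ hc, one_smul]
      have h2 := (g v).smul_mem (σ (inner ℂ e v)) (x := a + U ((inner ℂ e v : ℂ)⁻¹ • p v)) (by
        rw [h1, hsmul _ _ hc, ← h1]
        exact hUe _)
      rw [hσ.map_smul, smul_add, smul_smul, ← map_mul, mul_inv_cancel₀ hc, map_one,
        one_smul] at h2
      exact h2

theorem IsIndep.right_ne_zero {v w : H} (h : IsIndep v w) : w ≠ 0 := by
  rintro rfl
  exact one_ne_zero (h 0 1 (by simp)).2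

theorem IsIndep.adj {v w : H} (h : IsIndep v w) : Adj 0 (ℂ ∙ v) (ℂ ∙ w) := by
  have h1 := Adj.sup_span (HasDim.bot (H := H)) (x := v) (y := w)
    (fun h' => h.right_ne_zero ((mem_bot ℂ).1 h')) (fun h' => by
      rw [bot_sup_eq, mem_span_singleton] at h'
      obtain ⟨c, hc⟩ := h'
      have := (h 1 (-c) (by rw [← hc]; module)).1
      exact one_ne_zero this)
  rwa [bot_sup_eq, bot_sup_eq] at h1

namespace PreservesOrthoAdj

variable {m : ℕ} {F : Submodule ℂ H → Submodule ℂ H}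

/-- Induction by descent, ending with planes, where the descended map acts on lines. The same `U`
works at each level, because every vector of `X` lies in some hyperplane `Z` of `X` and `G Z ≤ F X`.
-/
theorem exists_isSemiIsometry (hn : ((2 * (m + 2) + 1 : ℕ) : Cardinal) ≤ Module.rank ℂ H)
    (hF : PreservesOrthoAdj (m + 1) F) : ∃ (σ : ℂ →+* ℂ) (U : H → H), IsSemiIsometry σ U ∧
      ∀ X, HasDim (m + 2) X → ∀ x ∈ X, U x ∈ F X := by
  induction m generalizing F with
  | zero =>
    obtain ⟨G, hG, hGF⟩ := hF.exists_descent hn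
    obtain ⟨σ, U, hU, hUG⟩ := exists_isSemiIsometry_of_lines (hn.trans' (by norm_num))
      (fun v => G (ℂ ∙ v)) (fun v hv => hG.dim (HasDim.span_singleton hv))
      (fun v w hv hw h => hG.ortho (HasDim.span_singleton hv) (HasDim.span_singleton hw) (by
        rw [isOrtho_span]
        rintro _ rfl _ rfl
        exact h))
      (fun v w u hu h hus => by
        have h1 := h.adj
        have h2 := (hG.adj h1).sup.eq_of_le (hF.dim h1.sup)
          (sup_le (hGF _ _ h1.left h1.sup le_sup_left) (hGF _ _ h1.right h1.sup le_sup_right))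
          le_rfl
        rw [h2]
        exact hGF _ _ (HasDim.span_singleton hu) h1.sup ((span_singleton_le_iff_mem _ _).2 hus))
      (fun v w h => (hG.adj h.adj).inter.eq_bot)
      (fun c v hc => congrArg G (span_singleton_smul_eq hc.isUnit v))
    refine ⟨σ, U, hU, fun X hX x hx => ?_⟩
    by_cases hx0 : x = 0
    · have : U x = 0 := by rw [← norm_eq_zero, hU.norm_map, hx0, norm_zero]
      rw [this]
      exact zero_mem _
    · exact hGF _ _ (HasDim.span_singleton hx0) hX ((span_singleton_le_iff_mem _ _).2 hx)
        (hUG x hx0)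
  | succ m ih =>
    obtain ⟨G, hG, hGF⟩ := hF.exists_descent hn
    obtain ⟨σ, U, hU, hUG⟩ := ih (hn.trans' (by exact_mod_cast (by omega))) hG
    refine ⟨σ, U, hU, fun X hX x hx => ?_⟩
    obtain ⟨a, ha, hxa⟩ : ∃ a ≤ 1, HasDim a (ℂ ∙ x) := by
      by_cases hx0 : x = 0
      · exact ⟨0, by omega, by rw [hx0, span_zero_singleton]; exact HasDim.bot⟩
      · exact ⟨1, le_rfl, HasDim.span_singleton hx0⟩
    obtain ⟨Z, hxZ, hZX, hZ⟩ := hxa.exists_between hX ((span_singleton_le_iff_mem _ _).2 hx)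
      (m := m + 2) (by omega) (by omega)
    exact hGF Z X hZ hX hZX (hUG Z hZ x (hxZ (mem_span_singleton_self x)))

end PreservesOrthoAdj

/-! ### From the isometry to the induced map: condition (A). -/

/-- Pythagoras for `v + c • w` kills the real part of `σ c * ⟨U v, U w⟩`; the values `c = 1` and `c
= i` suffice. -/
theorem IsSemiIsometry.inner_map {σ : ℂ →+* ℂ} {U : H → H} (h : IsSemiIsometry σ U) {v w : H}
    (hvw : inner ℂ v w = (0 : ℂ)) : inner ℂ (U v) (U w) = (0 : ℂ) := by
  have h1 : ∀ c : ℂ, ‖U v + σ c • U w‖ * ‖U v + σ c • U w‖ = ‖v‖ * ‖v‖ + ‖c • w‖ * ‖c • w‖ := by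
    intro c
    rw [← h.map_smul, ← h.map_add, h.norm_map,
      norm_add_sq_eq_norm_sq_add_norm_sq_of_inner_eq_zero (𝕜 := ℂ) _ _
        (by rw [inner_smul_right, hvw, mul_zero])]
  have hσn : ∀ c, ‖σ c‖ = ‖c‖ := fun c => by
    rcases h.id_or_conj with h | h <;> simp [h]
  have h2 : ∀ c : ℂ, (σ c * inner ℂ (U v) (U w)).re = 0 := by
    intro c
    have h3 := h1 c
    rw [← sq, norm_add_sq (𝕜 := ℂ), inner_smul_right, norm_smul, norm_smul, hσn, h.norm_map,
      h.norm_map, RCLike.re_eq_complex_re] at h3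
    linarith
  have h3 := h2 1
  have h4 := h2 Complex.I
  rw [map_one, one_mul] at h3
  refine Complex.ext h3 ?_
  rcases h.id_or_conj with h | h <;> simpa [h] using h4

/-- An orthonormal basis of `X` goes to `k` orthonormal vectors of `Y`, which span it; surjectivity
of `σ` lifts the coefficients. -/
theorem IsSemiIsometry.eq_image {σ : ℂ →+* ℂ} {U : H → H} (h : IsSemiIsometry σ U) {k : ℕ}
    {X Y : Submodule ℂ H} (hX : HasDim k X) (hY : HasDim k Y) (hXY : ∀ x ∈ X, U x ∈ Y) :
    ∀ y, y ∈ Y ↔ ∃ x ∈ X, U x = y := by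
  have := hX.1
  have := hY.1
  let b := stdOrthonormalBasis ℂ X
  have ho : Orthonormal ℂ fun i => U (b i) := by
    refine ⟨fun i => ?_, fun i j hij => h.inner_map ?_⟩
    · rw [h.norm_map]
      exact b.orthonormal.1 i
    · exact b.orthonormal.2 hij
  have h1 : span ℂ (Set.range fun i => U (b i)) = Y := by
    have h2 : HasDim k (span ℂ (Set.range fun i => U (b i))) := by
      refine ⟨FiniteDimensional.span_of_finite ℂ (Set.finite_range _), ?_⟩
      rw [finrank_span_eq_card ho.linearIndependent, Fintype.card_fin, hX.2]
    refine h2.eq_of_le hY (span_le.2 ?_) le_rfl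
    rintro _ ⟨i, rfl⟩
    exact hXY _ (b i).2
  have hsurj : ∀ c, ∃ d, σ d = c := fun c => by
    rcases h.id_or_conj with h | h
    · exact ⟨c, by simp [h]⟩
    · exact ⟨starRingEnd ℂ c, by simp [h]⟩
  intro y
  refine ⟨fun hy => ?_, fun ⟨x, hx, e⟩ => e ▸ hXY x hx⟩
  rw [← h1] at hy
  induction hy using span_induction with
  | mem x hx =>
    obtain ⟨i, rfl⟩ := hx
    exact ⟨_, (b i).2, rfl⟩
  | zero => exact ⟨0, X.zero_mem, by rw [← norm_eq_zero, h.norm_map, norm_zero]⟩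
  | add x y _ _ hx hy =>
    obtain ⟨x', hx', rfl⟩ := hx
    obtain ⟨y', hy', rfl⟩ := hy
    exact ⟨x' + y', X.add_mem hx' hy', h.map_add _ _⟩
  | smul c x _ hx =>
    obtain ⟨x', hx', rfl⟩ := hx
    obtain ⟨d, rfl⟩ := hsurj c
    exact ⟨d • x', X.smul_mem _ hx', h.map_smul _ _⟩

theorem succ_le_rank_of_lt {n : ℕ} (h : (n : Cardinal) < Module.rank ℂ H) :
    ((n + 1 : ℕ) : Cardinal) ≤ Module.rank ℂ H := by
  rw [Nat.cast_add, Nat.cast_one]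
  exact Cardinal.add_one_le_of_lt h

open Classical in
/-- The extension of a map of the Grassmannian to all subspaces, with value `⊥` elsewhere. -/
noncomputable def extend {k : ℕ} (f : Grassmannian k H → Grassmannian k H) (X : Submodule ℂ H) :
    Submodule ℂ H :=
  if h : HasDim k X then (f ⟨X, h⟩).1 else ⊥

theorem extend_of_hasDim {k : ℕ} (f : Grassmannian k H → Grassmannian k H) {X : Submodule ℂ H}
    (h : HasDim k X) : extend f X = (f ⟨X, h⟩).1 := dif_pos h

theorem adjacent_iff_adj {m : ℕ} {X Y : Grassmannian (m + 1) H} :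
    Adjacent X Y ↔ Adj m X.1 Y.1 := by
  have := X.2.1
  refine ⟨fun h => ⟨X.2, Y.2, inferInstance, Nat.succ_injective h⟩, fun h => ?_⟩
  rw [Adjacent, h.inter.2]

theorem induced_of_preserves_adjacent {k : ℕ} (hk : 2 < 2 * k)
    (hdim : ((2 * k : ℕ) : Cardinal) < Module.rank ℂ H)
    (f : Grassmannian k H → Grassmannian k H) (horth : Preserves Orthogonal f)
    (hadj : Preserves Adjacent f) :
    InducedByLinearIsometry f ∨ InducedByConjLinearIsometry f := by
  obtain ⟨m, rfl⟩ : ∃ m, k = m + 2 := ⟨k - 2, by omega⟩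
  have hn := succ_le_rank_of_lt hdim
  have hF : PreservesOrthoAdj (m + 1) (extend f) := by
    refine ⟨fun {X} h => ?_, fun {X Y} hX hY h => ?_, fun {X Y} h => ?_⟩
    · rw [extend_of_hasDim f h]
      exact (f _).2
    · rw [extend_of_hasDim f hX, extend_of_hasDim f hY]
      exact horth ⟨X, hX⟩ ⟨Y, hY⟩ h
    · rw [extend_of_hasDim f h.left, extend_of_hasDim f h.right]
      exact adjacent_iff_adj.1 (hadj ⟨X, h.left⟩ ⟨Y, h.right⟩ (adjacent_iff_adj.2 h))
  obtain ⟨σ, U, hU, hUF⟩ := hF.exists_isSemiIsometry hn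
  have hmem : ∀ (X : Grassmannian (m + 2) H) y, y ∈ (f X).1 ↔ ∃ x ∈ X.1, U x = y := fun X =>
    hU.eq_image X.2 (f X).2 fun x hx => by
      have := hUF X.1 X.2 x hx
      rwa [extend_of_hasDim f X.2] at this
  rcases hU.id_or_conj with rfl | rfl
  · left
    exact ⟨⟨⟨⟨U, hU.map_add⟩, hU.map_smul⟩, hU.norm_map⟩, fun X => Submodule.ext (hmem X)⟩
  · right
    exact ⟨⟨⟨⟨U, hU.map_add⟩, hU.map_smul⟩, hU.norm_map⟩, fun X => Submodule.ext (hmem X)⟩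

/-! ### Ortho-adjacency preserving injections preserve adjacency. -/

/-- Ortho-adjacency in terms of the orthogonal complements of the intersection. -/
structure OrthoAdj (m : ℕ) (A B : Submodule ℂ H) : Prop extends Adj m A B where
  inner_eq_zero : ∀ u ∈ A, ∀ v ∈ B, u ∈ (A ⊓ B)ᗮ → v ∈ (A ⊓ B)ᗮ → inner ℂ u v = (0 : ℂ)

namespace OrthoAdj

variable {m : ℕ} {A B W : Submodule ℂ H}

theorem symm (h : OrthoAdj m A B) : OrthoAdj m B A :=
  ⟨h.toAdj.symm, fun u hu v hv hu' hv' => inner_eq_zero_symm.1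
    (h.inner_eq_zero v hv u hu (inf_comm A B ▸ hv') (inf_comm A B ▸ hu'))⟩

/-- The part of `B` orthogonal to `A ⊓ B` is orthogonal to all of `A`, so the remaining component of
`n`, which lies in `A`, must vanish. -/
theorem mem_right_of_mem_orthogonal (h : OrthoAdj m A B) {n : H} (hn : n ∈ A ⊔ B) (hnA : n ∈ Aᗮ) :
    n ∈ B := by
  have := h.inter.1
  obtain ⟨a, ha, b, hb, rfl⟩ := mem_sup.1 hn
  obtain ⟨d, hd, c, hc, rfl⟩ := (A ⊓ B).exists_add_mem_mem_orthogonal b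
  have hcB : c ∈ B := by simpa using B.sub_mem hb hd.2
  have hcA : ∀ v ∈ A, inner ℂ v c = (0 : ℂ) := by
    intro v hv
    obtain ⟨d', hd', v', hv', rfl⟩ := (A ⊓ B).exists_add_mem_mem_orthogonal v
    have hvA : v' ∈ A := by simpa using A.sub_mem hv hd'.1
    rw [inner_add_left, h.inner_eq_zero v' hvA c hcB hv' hc, hc d' hd', add_zero]
  have hadA := A.add_mem ha hd.1
  have h1 := hnA (a + d) hadA
  rw [← add_assoc, inner_add_right, hcA _ hadA, add_zero, inner_self_eq_zero] at h1
  rw [← add_assoc, h1, zero_add]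
  exact hcB

/-- Normal vectors of ortho-adjacent hyperplanes are orthogonal. -/
theorem inner_normal_eq_zero (h : OrthoAdj m A B) (hW : HasDim (m + 2) W) (hA : A ≤ W) (hB : B ≤ W)
    {n n' : H} (hn : n ∈ W) (hn' : n' ∈ W) (hnA : n ∈ Aᗮ) (hnB : n' ∈ Bᗮ) :
    inner ℂ n n' = (0 : ℂ) := by
  rw [← h.sup.eq_of_le hW (sup_le hA hB) le_rfl] at hn hn'
  exact inner_eq_zero_symm.1 (h.inner_eq_zero n' (h.symm.mem_right_of_mem_orthogonal
    (sup_comm A B ▸ hn') hnB) n (h.mem_right_of_mem_orthogonal hn hnA)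
    (orthogonal_le inf_le_right hnB) (orthogonal_le inf_le_left hnA))

end OrthoAdj

theorem isOrtho_span_singleton_iff {Z : Submodule ℂ H} {x : H} : Z ⟂ ℂ ∙ x ↔ x ∈ Zᗮ := by
  rw [isOrtho_comm, isOrtho_iff_le, span_singleton_le_iff_mem]

/-- Pairwise ortho-adjacent subspaces of an `(m + 2)`-dimensional space are at most `m + 2`. -/
theorem card_le_of_orthoAdj {m : ℕ} {ι : Type*} [Fintype ι] {A : ι → Submodule ℂ H}
    {W : Submodule ℂ H} (hW : HasDim (m + 2) W) (hA : ∀ i, HasDim (m + 1) (A i))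
    (hAW : ∀ i, A i ≤ W) (h : ∀ i j, i ≠ j → OrthoAdj m (A i) (A j)) :
    Fintype.card ι ≤ m + 2 := by
  have hex : ∀ i, ∃ n ∈ W, n ∈ (A i)ᗮ ∧ n ≠ 0 := by
    intro i
    have := (hA i).1
    obtain ⟨x, hx, hxA⟩ := hW.not_le (hA i) (by omega)
    obtain ⟨a, ha, n, hn, rfl⟩ := (A i).exists_add_mem_mem_orthogonal x
    refine ⟨n, by simpa using W.sub_mem hx (hAW i ha), hn, ?_⟩
    rintro rfl
    exact hxA (by simpa using ha)
  choose n hnW hnA hn0 using hex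
  have hli := linearIndependent_of_ne_zero_of_inner_eq_zero (𝕜 := ℂ) hn0 fun i j hij =>
    (h i j hij).inner_normal_eq_zero hW (hAW i) (hAW j) (hnW i) (hnW j) (hnA i) (hnA j)
  have h1 : HasDim (Fintype.card ι) (span ℂ (Set.range n)) :=
    ⟨FiniteDimensional.span_of_finite ℂ (Set.finite_range _), finrank_span_eq_card hli⟩
  exact h1.le_dim hW (span_le.2 (by rintro _ ⟨i, rfl⟩; exact hnW i))

theorem HasDim.exists_orthonormal {m : ℕ} {Y : Submodule ℂ H} (hY : HasDim m Y) :
    ∃ y : Fin m → H, Orthonormal ℂ y ∧ (∀ i, y i ∈ Y) ∧ span ℂ (Set.range y) = Y := by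
  have := hY.1
  let b := (stdOrthonormalBasis ℂ Y).reindex (finCongr hY.2)
  have ho : Orthonormal ℂ fun i => (b i : H) := b.orthonormal.comp_linearIsometry Y.subtypeₗᵢ
  refine ⟨fun i => b i, ho, fun i => (b i).2, ?_⟩
  have h2 : HasDim m (span ℂ (Set.range fun i => (b i : H))) := by
    refine ⟨FiniteDimensional.span_of_finite ℂ (Set.finite_range _), ?_⟩
    rw [finrank_span_eq_card ho.linearIndependent, Fintype.card_fin]
  exact h2.eq_of_le hY (span_le.2 (by rintro _ ⟨i, rfl⟩; exact (b i).2)) le_rfl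

theorem HasDim.exists_unit_of_le {m : ℕ} {Z X : Submodule ℂ H} (hZ : HasDim m Z)
    (hX : HasDim (m + 1) X) (h : Z ≤ X) : ∃ x : H, ‖x‖ = 1 ∧ x ∈ Zᗮ ∧ X = Z ⊔ ℂ ∙ x := by
  have := hZ.1
  obtain ⟨x, hx, hxZ⟩ := hX.not_le hZ (by omega)
  obtain ⟨d, hd, z, hz, rfl⟩ := Z.exists_add_mem_mem_orthogonal x
  have hzX : z ∈ X := by simpa using X.sub_mem hx (h hd)
  have hz0 : z ≠ 0 := by rintro rfl; exact hxZ (by simpa using hd)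
  have hu := norm_smul_inv_norm (𝕜 := ℂ) hz0
  set u := (((‖z‖⁻¹ : ℝ) : ℂ) • z) with hu_def
  have hu' : ‖u‖ = 1 := by simpa [hu_def] using hu
  have huZ : u ∈ Zᗮ := Zᗮ.smul_mem _ hz
  refine ⟨u, hu', huZ, ((hZ.sup_span_isOrtho (norm_ne_zero_iff.1 (by rw [hu']; exact one_ne_zero))
    (isOrtho_span_singleton_iff.2 huZ)).eq_of_le hX
      (sup_le h ((span_singleton_le_iff_mem _ _).2 (X.smul_mem _ hzX))) le_rfl).symm⟩

/-- A map that preserves the ortho-adjacency of spanned subspaces. -/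
structure PreservesOrthoAdjacent (m : ℕ) (F : Submodule ℂ H → Submodule ℂ H) : Prop where
  dim : ∀ {X}, HasDim (m + 1) X → HasDim (m + 1) (F X)
  orthoAdj : ∀ {Z : Submodule ℂ H} {x y : H}, HasDim m Z → ‖x‖ = 1 → ‖y‖ = 1 → x ∈ Zᗮ → y ∈ Zᗮ →
    inner ℂ x y = (0 : ℂ) → OrthoAdj m (F (Z ⊔ ℂ ∙ x)) (F (Z ⊔ ℂ ∙ y))

theorem ne_zero_of_norm_eq_one {H : Type*} [NormedAddCommGroup H] {x : H}
    (hx : ‖x‖ = 1) : x ≠ 0 := by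
  rintro rfl
  simp at hx

namespace PreservesOrthoAdjacent

variable {m : ℕ} {F : Submodule ℂ H → Submodule ℂ H}

/-- With `m + 1` further orthonormal vectors, `x` yields `m + 4` pairwise ortho-adjacent images; a
top holds at most `m + 3`, so they form part of a star. -/
theorem inf_le (hn : ((2 * (m + 2) + 1 : ℕ) : Cardinal) ≤ Module.rank ℂ H)
    (hF : PreservesOrthoAdjacent (m + 1) F) {Z : Submodule ℂ H} (hZ : HasDim (m + 1) Z)
    {x : Fin 3 → H} (hx : Orthonormal ℂ x) (hxZ : ∀ i, x i ∈ Zᗮ) :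
    F (Z ⊔ ℂ ∙ x 1) ⊓ F (Z ⊔ ℂ ∙ x 2) ≤ F (Z ⊔ ℂ ∙ x 0) := by
  have hS : HasDim 3 (span ℂ (Set.range x)) :=
    ⟨FiniteDimensional.span_of_finite ℂ (Set.finite_range _), by
      rw [finrank_span_eq_card hx.linearIndependent, Fintype.card_fin]⟩
  have hZS : Z ⟂ span ℂ (Set.range x) := by
    rw [isOrtho_comm, isOrtho_iff_le, span_le]
    rintro _ ⟨i, rfl⟩
    exact hxZ i
  obtain ⟨Y, hY, hY'⟩ := (hZ.sup_ortho hS hZS).exists_ortho hn (p := m + 1) (by omega)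
  rw [isOrtho_sup_right] at hY
  obtain ⟨y, hy, hyY, -⟩ := hY'.exists_orthonormal
  have hxy : ∀ i j, inner ℂ (x i) (y j) = (0 : ℂ) := fun i j =>
    hY.2.symm.inner_eq (subset_span ⟨i, rfl⟩) (hyY j)
  let v : Fin 3 ⊕ Fin (m + 1) → H := Sum.elim x y
  have hv : ∀ i, ‖v i‖ = 1 := by
    rintro (i | i)
    · exact hx.1 i
    · exact hy.1 i
  have hvZ : ∀ i, v i ∈ Zᗮ := by
    rintro (i | i)
    · exact hxZ i
    · exact (isOrtho_iff_le.1 hY.1) (hyY i)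
  have hvv : ∀ i j, i ≠ j → inner ℂ (v i) (v j) = (0 : ℂ) := by
    rintro (i | i) (j | j) hij
    · exact hx.2 fun h => hij (congrArg _ h)
    · exact hxy i j
    · exact inner_eq_zero_symm.1 (hxy j i)
    · exact hy.2 fun h => hij (congrArg _ h)
  have hadj : ∀ i j, i ≠ j → OrthoAdj (m + 1) (F (Z ⊔ ℂ ∙ v i)) (F (Z ⊔ ℂ ∙ v j)) :=
    fun i j hij => hF.orthoAdj hZ (hv i) (hv j) (hvZ i) (hvZ j) (hvv i j hij)
  have h12 := (hadj (Sum.inl 1) (Sum.inl 2) (by simp)).toAdj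
  rcases h12.star_or_top (S := Set.range fun i => F (Z ⊔ ℂ ∙ v i)) ⟨_, rfl⟩ ⟨_, rfl⟩ (by
    rintro _ ⟨i, rfl⟩ _ ⟨j, rfl⟩
    by_cases hij : i = j
    · exact Or.inl (by rw [hij])
    · exact Or.inr (hadj i j hij).toAdj) with h | h
  · exact h _ ⟨Sum.inl 0, rfl⟩
  · have := card_le_of_orthoAdj h12.sup (fun i => hF.dim (hZ.sup_span_isOrtho
      (ne_zero_of_norm_eq_one (hv i)) (isOrtho_span_singleton_iff.2 (hvZ i))))
      (fun i => h _ ⟨i, rfl⟩) hadj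
    simp only [Fintype.card_sum, Fintype.card_fin] at this
    omega

/-- Two orthonormal directions orthogonal to `X ⊔ Y` complete both `X` and `Y` to triples as in
`inf_le`, so `F X` and `F Y` share an `(m + 1)`-dimensional subspace; injectivity keeps them
distinct. -/
theorem adj (hn : ((2 * (m + 2) + 1 : ℕ) : Cardinal) ≤ Module.rank ℂ H)
    (hF : PreservesOrthoAdjacent (m + 1) F)
    (hinj : ∀ X Y, HasDim (m + 2) X → HasDim (m + 2) Y → F X = F Y → X = Y)
    {X Y : Submodule ℂ H} (h : Adj (m + 1) X Y) : Adj (m + 1) (F X) (F Y) := by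
  obtain ⟨R, hR, hR'⟩ := h.sup.exists_ortho hn (p := 2) (by omega)
  obtain ⟨y, hy, hyR, -⟩ := hR'.exists_orthonormal
  have hyZ : ∀ i, y i ∈ (X ⊓ Y)ᗮ := fun i =>
    orthogonal_le (inf_le_left.trans le_sup_left) (isOrtho_iff_le.1 hR (hyR i))
  have key : ∀ V, HasDim (m + 2) V → X ⊓ Y ≤ V → V ≤ X ⊔ Y →
      F (X ⊓ Y ⊔ ℂ ∙ y 0) ⊓ F (X ⊓ Y ⊔ ℂ ∙ y 1) ≤ F V := by
    intro V hV hZV hVS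
    obtain ⟨x, hx, hxZ, rfl⟩ := h.inter.exists_unit_of_le hV hZV
    have hxy : ∀ i, inner ℂ (y i) x = (0 : ℂ) := fun i =>
      hR.inner_eq (hyR i) (hVS (mem_sup_right (mem_span_singleton_self x)))
    have h1 : Orthonormal ℂ (Matrix.vecCons x y) :=
      orthonormal_vecCons_iff.2 ⟨hx, fun i => inner_eq_zero_symm.1 (hxy i), hy⟩
    have h2 : ∀ i, (Matrix.vecCons x y : Fin 3 → H) i ∈ (X ⊓ Y)ᗮ := fun i => by
      induction i using Fin.cases with
      | zero => exact hxZ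
      | succ i => exact hyZ i
    have h3 := hF.inf_le hn h.inter h1 h2
    have e1 : (Matrix.vecCons x y : Fin 3 → H) 1 = y 0 := rfl
    have e2 : (Matrix.vecCons x y : Fin 3 → H) 2 = y 1 := rfl
    rwa [e1, e2, Matrix.cons_val_zero] at h3
  exact Adj.of_common (hF.dim h.left) (hF.dim h.right)
    (fun e => h.ne (hinj X Y h.left h.right e))
    (hF.orthoAdj h.inter (hy.1 0) (hy.1 1) (hyZ 0) (hyZ 1) (hy.2 (by simp))).inter
    (key X h.left inf_le_left le_sup_left) (key Y h.right inf_le_right le_sup_right)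

end PreservesOrthoAdjacent

/-! ### Principal angles and ortho-adjacency. -/

theorem OrthoAdjacent.orthoAdj {m : ℕ} {X Y : Grassmannian (m + 1) H} (h : OrthoAdjacent X Y) :
    OrthoAdj m X.1 Y.1 := by
  obtain ⟨hadj, θ, ⟨x, y, hxy⟩, hθ⟩ := h
  have hadj := adjacent_iff_adj.1 hadj
  refine ⟨hadj, fun u hu v hv hu' hv' => ?_⟩
  have hpar : ∀ i, θ i = 0 → x i ∈ X.1 ⊓ Y.1 ∧ y i ∈ X.1 ⊓ Y.1 := by
    intro i hi
    obtain ⟨⟨hxX, hyY, hx1, hy1, -⟩, hθi, -⟩ := hxy i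
    rw [hθi, Real.arccos_eq_zero] at hi
    have h1 : ‖inner ℂ (x i) (y i)‖ = ‖x i‖ * ‖y i‖ :=
      le_antisymm (norm_inner_le_norm _ _) (by rw [hx1, hy1, mul_one]; exact hi)
    obtain ⟨r, hr, e⟩ := (norm_inner_eq_norm_iff (ne_zero_of_norm_eq_one hx1)
      (ne_zero_of_norm_eq_one hy1)).1 h1
    refine ⟨⟨hxX, ?_⟩, ⟨?_, hyY⟩⟩
    · have := Y.1.smul_mem r⁻¹ hyY
      rwa [e, smul_smul, inv_mul_cancel₀ hr, one_smul] at this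
    · rw [e]
      exact X.1.smul_mem r hxX
  have hexi : ∃ i, θ i ≠ 0 := by
    by_contra! hc
    have ho : Orthonormal ℂ x := by
      refine ⟨fun i => (hxy i).1.2.2.1, fun i j hij => ?_⟩
      rcases lt_or_gt_of_ne hij with h | h
      · exact ((hxy j).1.2.2.2.2 i h).1
      · exact inner_eq_zero_symm.1 ((hxy i).1.2.2.2.2 j h).1
    have h1 : HasDim (m + 1) (span ℂ (Set.range x)) :=
      ⟨FiniteDimensional.span_of_finite ℂ (Set.finite_range _), by
        rw [finrank_span_eq_card ho.linearIndependent, Fintype.card_fin]⟩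
    have := h1.le_dim hadj.inter (span_le.2 (by
      rintro _ ⟨i, rfl⟩
      exact (hpar i (hc i)).1))
    omega
  -- Before the first nonzero angle all chosen vectors lie in `X ⊓ Y`, so unit vectors of `X` and
  -- `Y` orthogonal to `X ⊓ Y` compete at step `i`, where the minimum is `π / 2`.
  obtain ⟨i, hi, hmin⟩ := wellFounded_lt.has_min {i | θ i ≠ 0} hexi
  have hZ : ∀ j, j < i → x j ∈ X.1 ⊓ Y.1 ∧ y j ∈ X.1 ⊓ Y.1 := fun j hj =>
    hpar j (by_contra fun h => hmin j h hj)
  have hunit : ∀ u ∈ X.1, ∀ v ∈ Y.1, u ∈ (X.1 ⊓ Y.1)ᗮ → v ∈ (X.1 ⊓ Y.1)ᗮ → ‖u‖ = 1 → ‖v‖ = 1 →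
      inner ℂ u v = (0 : ℂ) := by
    intro u hu v hv hu' hv' hu1 hv1
    have h1 := (hxy i).2.2 u v ⟨hu, hv, hu1, hv1, fun j hj =>
      ⟨hu' _ (hZ j hj).1, hv' _ (hZ j hj).2⟩⟩
    rw [hθ i hi] at h1
    by_contra hne
    exact absurd (Real.arccos_lt_pi_div_two.2 (norm_pos_iff.2 hne)) (not_lt.2 h1)
  by_cases hu0 : u = 0
  · rw [hu0, inner_zero_left]
  by_cases hv0 : v = 0
  · rw [hv0, inner_zero_right]
  have h1 := hunit _ (X.1.smul_mem ((‖u‖ : ℂ)⁻¹) hu) _ (Y.1.smul_mem ((‖v‖ : ℂ)⁻¹) hv)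
    ((X.1 ⊓ Y.1)ᗮ.smul_mem _ hu') ((X.1 ⊓ Y.1)ᗮ.smul_mem _ hv')
    (norm_smul_inv_norm (𝕜 := ℂ) hu0) (norm_smul_inv_norm (𝕜 := ℂ) hv0)
  simpa [inner_smul_left, inner_smul_right, hu0, hv0] using h1

theorem exists_eq_smul_of_mem_sup_span {Z : Submodule ℂ H} {x u : H} (hx : x ∈ Zᗮ)
    (hu : u ∈ Z ⊔ ℂ ∙ x) (huZ : u ∈ Zᗮ) : ∃ c : ℂ, u = c • x := by
  obtain ⟨z, hz, w, hw, rfl⟩ := mem_sup.1 hu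
  obtain ⟨c, rfl⟩ := mem_span_singleton.1 hw
  have h1 := huZ z hz
  rw [inner_add_right, inner_smul_right, hx z hz, mul_zero, add_zero, inner_self_eq_zero] at h1
  exact ⟨c, by rw [h1, zero_add]⟩

theorem orthoAdjacent_sup_span {m : ℕ} {Z : Submodule ℂ H} (hZ : HasDim m Z) {x y : H}
    (hx : ‖x‖ = 1) (hy : ‖y‖ = 1) (hxZ : x ∈ Zᗮ) (hyZ : y ∈ Zᗮ) (hxy : inner ℂ x y = (0 : ℂ))
    (hX : HasDim (m + 1) (Z ⊔ ℂ ∙ x)) (hY : HasDim (m + 1) (Z ⊔ ℂ ∙ y)) :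
    OrthoAdjacent (k := m + 1) ⟨Z ⊔ ℂ ∙ x, hX⟩ ⟨Z ⊔ ℂ ∙ y, hY⟩ := by
  have hne : Z ⊔ ℂ ∙ x ≠ Z ⊔ ℂ ∙ y := by
    intro e
    have h1 : x ∈ Z ⊔ ℂ ∙ y := e ▸ mem_sup_right (mem_span_singleton_self x)
    obtain ⟨c, hc⟩ := exists_eq_smul_of_mem_sup_span hyZ h1 hxZ
    have h2 : inner ℂ x x = (0 : ℂ) := by
      nth_rewrite 2 [hc]
      rw [inner_smul_right, hxy, mul_zero]
    exact ne_zero_of_norm_eq_one hx (inner_self_eq_zero.1 h2)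
  refine ⟨adjacent_iff_adj.2 (Adj.of_common hX hY hne hZ le_sup_left le_sup_left), ?_⟩
  obtain ⟨b, hb, hbZ, hspan⟩ := hZ.exists_orthonormal
  have hlast : ∀ w : H, ∀ u, (∀ j, j < Fin.last m →
      inner ℂ ((Fin.snoc b w : Fin (m + 1) → H) j) u = (0 : ℂ)) → u ∈ Zᗮ := by
    intro w u h
    have h1 : Z ≤ (ℂ ∙ u)ᗮ := by
      rw [← hspan, span_le]
      rintro _ ⟨i, rfl⟩
      have := h i.castSucc (Fin.castSucc_lt_last i)
      rw [Fin.snoc_castSucc] at this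
      exact mem_orthogonal_singleton_iff_inner_left.2 this
    intro z hz
    exact mem_orthogonal_singleton_iff_inner_left.1 (h1 hz)
  have hcomp : ∀ w : H, ‖w‖ = 1 → w ∈ Zᗮ → ∀ i, (Fin.snoc b w : Fin (m + 1) → H) i ∈ Z ⊔ ℂ ∙ w ∧
      ‖(Fin.snoc b w : Fin (m + 1) → H) i‖ = 1 ∧ ∀ j, j < i →
      inner ℂ ((Fin.snoc b w : Fin (m + 1) → H) j) ((Fin.snoc b w : Fin (m + 1) → H) i) =
        (0 : ℂ) := by
    intro w hw hwZ i
    induction i using Fin.lastCases with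
    | last =>
      rw [Fin.snoc_last]
      refine ⟨mem_sup_right (mem_span_singleton_self w), hw, fun j hj => ?_⟩
      induction j using Fin.lastCases with
      | last => exact absurd hj (lt_irrefl _)
      | cast j =>
        rw [Fin.snoc_castSucc]
        exact hwZ _ (hbZ j)
    | cast i =>
      rw [Fin.snoc_castSucc]
      refine ⟨mem_sup_left (hbZ i), hb.1 i, fun j hj => ?_⟩
      induction j using Fin.lastCases with
      | last => exact absurd hj (not_lt.2 (Fin.le_last _))
      | cast j =>
        rw [Fin.snoc_castSucc]
        exact hb.2 (fun h => by rw [h] at hj; exact lt_irrefl _ hj)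
  -- Principal vectors: a common orthonormal basis `b` of `Z` with angles `0`, then the pair `x`,
  -- `y` with angle `π / 2`. By `hlast`, competitors at the last step are multiples of `x` and `y`.
  refine ⟨fun i => Real.arccos ‖inner ℂ ((Fin.snoc b x : Fin (m + 1) → H) i)
    ((Fin.snoc b y : Fin (m + 1) → H) i)‖, ⟨Fin.snoc b x, Fin.snoc b y, fun i => ⟨?_, rfl, ?_⟩⟩,
    fun i => ?_⟩
  · have h1 := hcomp x hx hxZ i
    have h2 := hcomp y hy hyZ i
    exact ⟨h1.1, h2.1, h1.2.1, h2.2.1, fun j hj => ⟨h1.2.2 j hj, h2.2.2 j hj⟩⟩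
  · induction i using Fin.lastCases with
    | last =>
      rintro u v ⟨hu, hv, -, -, huv⟩
      obtain ⟨c, rfl⟩ := exists_eq_smul_of_mem_sup_span hxZ hu (hlast x u fun j hj => (huv j hj).1)
      obtain ⟨d, rfl⟩ := exists_eq_smul_of_mem_sup_span hyZ hv (hlast y v fun j hj => (huv j hj).2)
      simp [hxy]
    | cast i =>
      intro u v _
      have : Real.arccos ‖inner ℂ (b i) (b i)‖ = 0 := by
        rw [inner_self_eq_norm_sq_to_K, hb.1 i]
        simp
      simpa only [Fin.snoc_castSucc, this] using Real.arccos_nonneg _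
  · induction i using Fin.lastCases with
    | last => simp [hxy]
    | cast i => simp [inner_self_eq_norm_sq_to_K, hb.1 i]

theorem preserves_adjacent_of_injective {k : ℕ} (hk : 2 < 2 * k)
    (hdim : ((2 * k : ℕ) : Cardinal) < Module.rank ℂ H)
    (f : Grassmannian k H → Grassmannian k H) (hinj : Function.Injective f)
    (hf : Preserves OrthoAdjacent f) : Preserves Adjacent f := by
  obtain ⟨m, rfl⟩ : ∃ m, k = m + 2 := ⟨k - 2, by omega⟩
  have hF : PreservesOrthoAdjacent (m + 1) (extend f) := by
    refine ⟨fun {X} h => ?_, fun {Z x y} hZ hx hy hxZ hyZ hxy => ?_⟩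
    · rw [extend_of_hasDim f h]
      exact (f _).2
    · have hX := hZ.sup_span_isOrtho (ne_zero_of_norm_eq_one hx)
        (isOrtho_span_singleton_iff.2 hxZ)
      have hY := hZ.sup_span_isOrtho (ne_zero_of_norm_eq_one hy)
        (isOrtho_span_singleton_iff.2 hyZ)
      rw [extend_of_hasDim f hX, extend_of_hasDim f hY]
      exact (hf _ _ (orthoAdjacent_sup_span hZ hx hy hxZ hyZ hxy hX hY)).orthoAdj
  intro X Y h
  have h1 := hF.adj (succ_le_rank_of_lt hdim) (fun X Y hX hY e => by
    rw [extend_of_hasDim f hX, extend_of_hasDim f hY] at e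
    exact congrArg Subtype.val (hinj (Subtype.ext e))) (adjacent_iff_adj.1 h)
  rw [extend_of_hasDim f X.2, extend_of_hasDim f Y.2] at h1
  exact adjacent_iff_adj.2 h1

end HilbertGrassmannian

theorem theorem1 {H : Type*} [NormedAddCommGroup H] [InnerProductSpace ℂ H] [CompleteSpace H]
    (k : ℕ) (hk : 2 < 2 * k) (hdim : ((2 * k : ℕ) : Cardinal) < Module.rank ℂ H)
    (f : HilbertGrassmannian.Grassmannian k H → HilbertGrassmannian.Grassmannian k H)
    (horth : HilbertGrassmannian.Preserves HilbertGrassmannian.Orthogonal f)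
    (hcond : HilbertGrassmannian.Preserves HilbertGrassmannian.Adjacent f ∨
      (Function.Injective f ∧
        HilbertGrassmannian.Preserves HilbertGrassmannian.OrthoAdjacent f)) :
    HilbertGrassmannian.InducedByLinearIsometry f ∨
      HilbertGrassmannian.InducedByConjLinearIsometry f := by
  refine HilbertGrassmannian.induced_of_preserves_adjacent hk hdim f horth ?_
  rcases hcond with h | ⟨hinj, h⟩
  · exact h
  · exact HilbertGrassmannian.preserves_adjacent_of_injective hk hdim f hinj h
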